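/- Let $m_+,m_->0$, put $M=m_++m_-$, $\mu_\pm=m_\pm/M$. For $p>0$ and a bounded measurable $V:\mathbb R^3\to\mathbb R$ consider on $L^2(\mathbb R^3)$ the self-adjoint operator $$Q_p=H_p(i\nabla)-V_p(y),\qquad V_p(y)=p^{-1}V(p^{-1}y),$$ where, for $\xi=(\eta,\zeta)\in\mathbb R\times\mathbb R^2$, $$H_p(\xi)=\sqrt{(\eta-\mu_+)^2+|\zeta|^2+\mu_+^2M^2p^{-2}}+\sqrt{(\eta+\mu_-)^2+|\zeta|^2+\mu_-^2M^2p^{-2}}-\sqrt{1+M^2p^{-2}}.$$ Let $N_p(V)=\operatorname{tr}\chi_{(-\infty,0)}(Q_p)\in\{0,1,2,\dots\}\cup\{\infty\}$ be the total number of negative eigenvalues of $Q_p$, counted with multiplicities ($\infty$ if the negative spectrum of $Q_p$ does not consist of finitely many eigenvalues of finite multiplicity). **Theorem.** Let $a,\gamma>0$ and $K\ge 0$. There is a finite constant $C$, depending only on $a$, $\gamma$, $K$ and the (fixed) masses $m_\pm$, such that the following holds. For every $b>0$ and every measurable $V:\mathbb R^3\to\mathbb R$ with $\|V\|_{L^\infty}\le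 K$ and $$V(x)\le -a\,(1+|x|-b)^{-\gamma}\qquad\text{for almost every }x\in\mathbb R^3\text{ with }|x|\ge b,$$ one has $$N_p(V)\le C\,(b+1)^3\,p^2\qquad\text{for all }p\ge M.$$ In particular, with $K=\|V\|_{L^\infty}$, for fixed masses $C=C(a,\gamma,\|V\|_{L^\infty})$ does not depend on $p$ and $b$. -/

import Mathlib

open MeasureTheory
open scoped ENNReal FourierTransform

noncomputable section

namespace PairOperator

/-! ### Spectral counting for (possibly unbounded) operators in a Hilbert space -/

section Spectral

variable {H : Type*} [NormedAddCommGroup H] [InnerProductSpace ℂ H]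

/-- `z` belongs to the resolvent set of the unbounded operator `A`: the map
`A - z : dom A → H` is a bijection whose inverse `R` is a bounded operator on `H`. -/
def InResolventSet (A : H →ₗ.[ℂ] H) (z : ℂ) : Prop :=
  ∃ R : H →L[ℂ] H,
    (∀ f : H, ∃ u : A.domain, (u : H) = R f ∧ A u - z • (u : H) = f) ∧
    ∀ u : A.domain, R (A u - z • (u : H)) = u

/-- The negative part `σ(A) ∩ (-∞, 0)` of the spectrum of `A`. -/
def negSpectrum (A : H →ₗ.[ℂ] H) : Set ℝ :=
  {t : ℝ | t < 0 ∧ ¬ InResolventSet A (t : ℂ)}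

/-- The eigenspace `{u ∈ dom A : A u = z u}`, as a subspace of `H`. -/
def eigenspace (A : H →ₗ.[ℂ] H) (z : ℂ) : Submodule ℂ H :=
  (LinearMap.ker (A.toFun - z • A.domain.subtype)).map A.domain.subtype

open Classical in
/-- The total number of negative eigenvalues of a self-adjoint operator `A`, counted with
multiplicities, that is `tr χ_{(-∞,0)}(A)`. If the negative spectrum is a finite set then it
consists of isolated points, which are eigenvalues, and the trace is the sum of their
multiplicities. If the negative spectrum is an infinite set, the spectral projection has
infinite rank and the value is `∞`. (The value is also `∞` if one multiplicity is infinite.) -/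
def negEigenvalueCount (A : H →ₗ.[ℂ] H) : ℕ∞ :=
  if h : (negSpectrum A).Finite then
    ∑ t ∈ h.toFinset, Cardinal.toENat (Module.rank ℂ (eigenspace A (t : ℂ)))
  else ⊤

end Spectral

/-! ### Multiplication operators and Fourier multipliers in `L²(ℝ³)` -/

/-- The Euclidean space `ℝ³`. -/
abbrev R3 : Type := EuclideanSpace ℝ (Fin 3)

/-- The complex Hilbert space `L²(ℝ³)`. -/
abbrev L2R3 : Type := Lp ℂ 2 (volume : Measure R3)

/-- The maximal domain `{u ∈ L² : m u ∈ L²}` of multiplication by the real function `m`. -/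
def mulDomain (m : R3 → ℝ) : Submodule ℂ L2R3 where
  carrier := {u | MemLp (fun x => (m x : ℂ) * u x) 2 volume}
  zero_mem' := by
    have h0 : MemLp (fun _ : R3 => (0 : ℂ)) 2 volume := MemLp.zero
    refine h0.ae_eq ?_
    filter_upwards [Lp.coeFn_zero ℂ 2 (volume : Measure R3)] with x hx
    rw [hx, Pi.zero_apply, mul_zero]
  add_mem' := by
    intro u v hu hv
    refine (MemLp.add hu hv).ae_eq ?_
    filter_upwards [Lp.coeFn_add u v] with x hx
    rw [hx, Pi.add_apply, Pi.add_apply, mul_add]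
  smul_mem' := by
    intro c u hu
    refine (MemLp.const_smul hu c).ae_eq ?_
    filter_upwards [Lp.coeFn_smul c u] with x hx
    rw [hx, Pi.smul_apply, Pi.smul_apply, smul_eq_mul, smul_eq_mul, mul_left_comm]

theorem memLp_of_mem_mulDomain {m : R3 → ℝ} {u : L2R3} (hu : u ∈ mulDomain m) :
    MemLp (fun x => (m x : ℂ) * u x) 2 volume := hu

/-- The product `m u` as an element of `L²`, for `u` in the maximal domain. -/
def mulValue (m : R3 → ℝ) (u : mulDomain m) : L2R3 :=
  (memLp_of_mem_mulDomain u.2).toLp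

theorem coeFn_mulValue (m : R3 → ℝ) (u : mulDomain m) :
    mulValue m u =ᵐ[volume] fun x => (m x : ℂ) * (u : L2R3) x :=
  MemLp.coeFn_toLp _

/-- The operator of multiplication by the real function `m`, on its maximal domain. -/
def mulOp (m : R3 → ℝ) : L2R3 →ₗ.[ℂ] L2R3 where
  domain := mulDomain m
  toFun :=
    { toFun := mulValue m
      map_add' := by
        intro u v
        apply Lp.ext
        filter_upwards [Lp.coeFn_add (u : L2R3) (v : L2R3), coeFn_mulValue m (u + v),
          coeFn_mulValue m u, coeFn_mulValue m v,
          Lp.coeFn_add (mulValue m u) (mulValue m v)] with x h1 h2 h3 h4 h5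
        rw [h2, h5, Submodule.coe_add, h1, Pi.add_apply, Pi.add_apply, h3, h4, mul_add]
      map_smul' := by
        intro c u
        apply Lp.ext
        filter_upwards [Lp.coeFn_smul c (u : L2R3), coeFn_mulValue m (c • u),
          coeFn_mulValue m u, Lp.coeFn_smul c (mulValue m u)] with x h1 h2 h3 h4
        rw [h2, RingHom.id_apply, h4, Submodule.coe_smul, h1, Pi.smul_apply, Pi.smul_apply, h3,
          smul_eq_mul, smul_eq_mul, mul_left_comm] }

/-- The operator `h(i∇)` for a real symbol `h`, that is `u ↦ 𝓕⁻¹ (h(-2πw) 𝓕 u)` on its maximal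
domain `{u ∈ L² : h(-2πw) 𝓕 u ∈ L²}`. In the normalization
`𝓕 u (w) = ∫ exp(-2πi⟨x, w⟩) u(x) dx` the operator `i∇` is multiplication by `-2πw`. -/
def symbolOp (h : R3 → ℝ) : L2R3 →ₗ.[ℂ] L2R3 where
  domain := (mulOp fun w => h (-(2 * Real.pi) • w)).domain.comap
    (Lp.fourierTransformₗᵢ R3 ℂ).toLinearEquiv.toLinearMap
  toFun :=
    (Lp.fourierTransformₗᵢ R3 ℂ).symm.toLinearEquiv.toLinearMap ∘ₗ
      (mulOp fun w => h (-(2 * Real.pi) • w)).toFun ∘ₗ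
        (Lp.fourierTransformₗᵢ R3 ℂ).toLinearEquiv.toLinearMap.restrict fun _ hu => hu

/-! ### The pair operator -/

/-- The symbol `T_±(ξ) = √((η - s)² + |ζ|² + t²)`, where `ξ = (η, ζ) ∈ ℝ × ℝ²`. -/
def kinetic (s t : ℝ) (ξ : R3) : ℝ :=
  √((ξ 0 - s) ^ 2 + (ξ 1 ^ 2 + ξ 2 ^ 2) + t ^ 2)

/-- The symbol
`H_p(ξ) = T_+(ξ) + T_-(ξ) - √(1 + M² p⁻²)`, with
`T_±(ξ) = √((η ∓ μ_±)² + |ζ|² + μ_±² M² p⁻²)`, `M = m_+ + m_-` and `μ_± = m_± / M`. -/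
def pairSymbol (mPlus mMinus p : ℝ) (ξ : R3) : ℝ :=
  let M := mPlus + mMinus
  kinetic (mPlus / M) (mPlus / M * M / p) ξ + kinetic (-(mMinus / M)) (mMinus / M * M / p) ξ
    - √(1 + M ^ 2 / p ^ 2)

/-- The rescaled potential `V_p(y) = p⁻¹ V(p⁻¹ y)`. -/
def scaledPotential (V : R3 → ℝ) (p : ℝ) (y : R3) : ℝ :=
  p⁻¹ * V (p⁻¹ • y)

/-- The pair operator `Q_p(i∇, y) = H_p(i∇) - V_p(y)` in `L²(ℝ³)`. Its domain is the intersection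
of the maximal domains of both terms; for bounded `V` this is the domain of `H_p(i∇)`. -/
def pairOperator (mPlus mMinus : ℝ) (V : R3 → ℝ) (p : ℝ) : L2R3 →ₗ.[ℂ] L2R3 :=
  symbolOp (pairSymbol mPlus mMinus p) - mulOp (scaledPotential V p)

/-- `N_p(V) = tr χ_{(-∞,0)}(Q_p(i∇, y))`, the number of negative eigenvalues of the pair operator,
counted with multiplicities. -/
def countN (mPlus mMinus : ℝ) (V : R3 → ℝ) (p : ℝ) : ℕ∞ :=
  negEigenvalueCount (pairOperator mPlus mMinus V p)

end PairOperator

end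

noncomputable section

namespace PairOperator

/-! ### Glazman's lemma for symmetric unbounded operators -/

section AbstractCounting

variable {H : Type*} [NormedAddCommGroup H] [InnerProductSpace ℂ H]

/-! The proof bounds the dimension of any subspace on which the quadratic form of `Q_p` is negative
by a phase space volume. Let B be the ball of radius bp and j² = (1 + (|y|/p - b)₊)^(-γ). The
hypotheses on V give -V_p ≥ (a/p) j² - ((K+a)/p) 1_B, so a negative energy must come from B
(`neg_scaledPotential_ge`). On the kinetic side, p H_p ≥ 2(K+a) outside a set η² + p|ζ|² ≤ ρ with ρ
independent of p (`exists_le_mul_pairSymbol`). With P a smooth Fourier cutoff to such a set, the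
kinetic energy pays for the part u - Pu, and the form is at least (a/p)‖ju‖² - (2(K+a)/p)‖1_B P u‖²
(`form_lower_bound`).

On a negative subspace, vectors with ‖ju‖ = 1 therefore satisfy ‖1_B P u‖² ≥ a/(2(K+a)), and the
dimension is at most 2(K+a)/a times the squared Hilbert-Schmidt norm of 1_B P j⁻¹
(`IsNegFamily.mul_card_le`). That norm is of order |B| times the momentum volume, (bp)³ · p⁻¹ =
b³p². The weight j⁻¹ is unbounded, but harmless: the kernel of P decays rapidly, and for y in B one
has j(z)⁻² ≤ (1 + |z-y|/p)^γ, a bound free of b (`inv_sqrtWeight_sq_le`,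
`weighted_integral_fourier_scaled`).

The passage from forms to the eigenvalue count is `negEigenvalueCount_le`, which also has to show
that the negative spectrum consists of finitely many eigenvalues. -/

theorem linearPMap_map_sum (A : H →ₗ.[ℂ] H) {ι : Type*} (s : Finset ι) (v : ι → A.domain) :
    A (∑ i ∈ s, v i) = ∑ i ∈ s, A (v i) :=
  map_sum A.toFun v s

/-- The quadratic form of `A` is negative on all nontrivial linear combinations of the family. -/
def IsNegFamily (A : H →ₗ.[ℂ] H) {ι : Type*} [Fintype ι] (v : ι → A.domain) : Prop :=
  ∀ c : ι → ℂ, c ≠ 0 →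
    (inner ℂ (A (∑ i, c i • v i)) ((∑ i, c i • v i : A.domain) : H)).re < 0

theorem IsNegFamily.comp_equiv {A : H →ₗ.[ℂ] H} {ι κ : Type*} [Fintype ι] [Fintype κ]
    {v : ι → A.domain} (hv : IsNegFamily A v) (e : κ ≃ ι) : IsNegFamily A (v ∘ e) := by
  intro c hc
  have h := hv (c ∘ e.symm) (fun h0 => hc (by
    funext j
    simpa using congrFun h0 (e j)))
  have hs : ∑ i, (c ∘ e.symm) i • v i = ∑ j, c j • (v ∘ e) j := by
    rw [← e.sum_comp]
    simp
  rwa [hs] at h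

/-- A maximal negative family: the form is nonnegative on its orthogonal complement with respect
to the form. -/
theorem exists_maximal_isNegFamily {A : H →ₗ.[ℂ] H}
    (hsym : ∀ u v : A.domain, inner ℂ (A u) (v : H) = inner ℂ (u : H) (A v)) {n : ℕ}
    (hn : ∀ (k : ℕ) (v : Fin k → A.domain), IsNegFamily A v → k ≤ n) :
    ∃ (k : ℕ) (v : Fin k → A.domain), ∀ u : A.domain,
      (∀ i, inner ℂ (A (v i)) (u : H) = 0) → 0 ≤ (inner ℂ (A u) (u : H)).re := by
  set S : Set ℕ := {k | ∃ v : Fin k → A.domain, IsNegFamily A v}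
  have hbdd : BddAbove S := ⟨n, fun k ⟨v, hv⟩ => hn k v hv⟩
  have hne : S.Nonempty :=
    ⟨0, fun i => i.elim0, fun c hc => (hc (Subsingleton.elim _ _)).elim⟩
  obtain ⟨v, hv⟩ : sSup S ∈ S := Nat.sSup_mem hne hbdd
  refine ⟨sSup S, v, fun u hu => ?_⟩
  by_contra! hneg
  -- A form-orthogonal vector with negative form would extend the longest family: the cross terms
  -- vanish, so the form of a combination splits into two nonpositive parts, one of them negative.
  have hmem : sSup S + 1 ∈ S := by
    refine ⟨Fin.cons u v, fun c hc => ?_⟩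
    have hsum : ∑ i, c i • (Fin.cons u v : Fin (sSup S + 1) → A.domain) i
        = c 0 • u + ∑ i, c i.succ • v i := by
      simp [Fin.sum_univ_succ]
    rw [hsum]
    set x : A.domain := ∑ i, c i.succ • v i with hx
    have hxu : inner ℂ (A x) (u : H) = 0 := by
      rw [hx, linearPMap_map_sum, sum_inner]
      refine Finset.sum_eq_zero fun i _ => ?_
      rw [LinearPMap.map_smul, inner_smul_left, hu i, mul_zero]
    have hux : inner ℂ (A u) (x : H) = 0 := by
      rw [hsym, ← inner_conj_symm, hxu, map_zero]
    have hform : (inner ℂ (A (c 0 • u + x)) ((c 0 • u + x : A.domain) : H)).re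
        = ‖c 0‖ ^ 2 * (inner ℂ (A u) (u : H)).re + (inner ℂ (A x) (x : H)).re := by
      rw [LinearPMap.map_add, LinearPMap.map_smul, Submodule.coe_add, Submodule.coe_smul,
        inner_add_left, inner_add_right, inner_add_right, inner_smul_left, inner_smul_left,
        inner_smul_right, inner_smul_right, hux, hxu, ← mul_assoc, Complex.conj_mul']
      simp only [mul_zero, add_zero, zero_add, Complex.add_re]
      rw [← Complex.ofReal_pow, Complex.re_ofReal_mul]
    rw [hform]
    by_cases h : (fun i : Fin (sSup S) => c i.succ) = 0
    · have hx0 : x = 0 := by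
        rw [hx]
        exact Finset.sum_eq_zero fun i _ => by rw [congrFun h i]; simp
      have hc0 : c 0 ≠ 0 := by
        intro h0
        apply hc
        funext i
        refine Fin.cases h0 (fun j => congrFun h j) i
      rw [hx0]
      have : 0 < ‖c 0‖ ^ 2 := by positivity
      simp only [Submodule.coe_zero, inner_zero_right, Complex.zero_re, add_zero]
      exact mul_neg_of_pos_of_neg this hneg
    · have h1 := hv _ h
      have h2 : ‖c 0‖ ^ 2 * (inner ℂ (A u) (u : H)).re ≤ 0 :=
        mul_nonpos_of_nonneg_of_nonpos (by positivity) hneg.le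
      linarith
  have := le_csSup hbdd hmem
  omega

/-- The quotient is isomorphic to S. This lets closedness of the image of Sᗮ imply closedness of a
full range. -/
theorem finiteDimensional_quotient_orthogonal [CompleteSpace H] (S : Submodule ℂ H)
    [FiniteDimensional ℂ S] : FiniteDimensional ℂ (H ⧸ Sᗮ) :=
  (Submodule.quotientEquivOfIsCompl Sᗮ S
    (Submodule.isCompl_orthogonal (K := S)).symm).symm.finiteDimensional

/-- If negative families have bounded length, a negative number is in the resolvent set unless it
is an eigenvalue. -/
theorem inResolventSet_of_forall_ne [CompleteSpace H] {A : H →ₗ.[ℂ] H}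
    (hsym : ∀ u v : A.domain, inner ℂ (A u) (v : H) = inner ℂ (u : H) (A v))
    {κ : ℝ} (hres : InResolventSet A (κ : ℂ)) {n : ℕ}
    (hn : ∀ (k : ℕ) (v : Fin k → A.domain), IsNegFamily A v → k ≤ n)
    {t : ℝ} (ht : t < 0) (hinj : ∀ u : A.domain, A u = (t : ℂ) • (u : H) → (u : H) = 0) :
    InResolventSet A (t : ℂ) := by
  obtain ⟨R, hR, hR'⟩ := hres
  obtain ⟨k, v, hv⟩ := exists_maximal_isNegFamily hsym hn
  set τ : ℝ := t - κ with hτ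
  -- With R = (A - κ)⁻¹ this is B = (A - t)R, so (A - t)⁻¹ = R B⁻¹ once the bounded symmetric
  -- operator B is invertible.
  set B : H →L[ℂ] H := ContinuousLinearMap.id ℂ H - (τ : ℂ) • R with hB
  have hBapp : ∀ f, B f = f - (τ : ℂ) • R f := fun f => rfl
  have hRsym : ∀ f g, inner ℂ (R f) g = inner ℂ f (R g) := by
    intro f g
    obtain ⟨u, hu, hu'⟩ := hR f
    obtain ⟨w, hw, hw'⟩ := hR g
    rw [← hu, ← hw, ← hu', ← hw', inner_sub_left, inner_sub_right, hsym, inner_smul_left,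
      inner_smul_right, Complex.conj_ofReal]
  have hBsym : ∀ f g, inner ℂ (B f) g = inner ℂ f (B g) := by
    intro f g
    rw [hBapp, hBapp, inner_sub_left, inner_sub_right, inner_smul_left, inner_smul_right,
      Complex.conj_ofReal, hRsym]
  have hBu : ∀ f, ∃ u : A.domain, (u : H) = R f ∧ A u - (t : ℂ) • (u : H) = B f := by
    intro f
    obtain ⟨u, hu, hu'⟩ := hR f
    refine ⟨u, hu, ?_⟩
    rw [hBapp, ← hu, ← hu', hτ]
    push_cast
    module
  have hBinj : ∀ f, B f = 0 → f = 0 := by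
    intro f hf
    obtain ⟨u, hu, hu'⟩ := hBu f
    have h0 := hinj u (by rw [hf] at hu'; exact sub_eq_zero.mp hu')
    rw [hBapp, ← hu, h0, smul_zero, sub_zero] at hf
    exact hf
  -- By symmetry of R, f ⊥ S means that u = Rf is form-orthogonal to the maximal family, so the form
  -- of A is nonnegative at u. As t < 0, this gives ⟨Bf, u⟩ ≥ |t|‖u‖², and f = Bf + τu is then
  -- controlled by Bf.
  set S : Submodule ℂ H := Submodule.span ℂ (Set.range fun i => R (A (v i))) with hS
  have : FiniteDimensional ℂ S := FiniteDimensional.span_of_finite ℂ (Set.finite_range _)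
  have := finiteDimensional_quotient_orthogonal S
  have hbelow : ∀ f ∈ Sᗮ, ‖f‖ ≤ (1 + |τ| / |t|) * ‖B f‖ := by
    intro f hf
    obtain ⟨u, hu, hu'⟩ := hBu f
    have hpos : 0 ≤ (inner ℂ (A u) (u : H)).re := by
      refine hv u fun i => ?_
      rw [hu, ← hRsym]
      exact (Submodule.mem_orthogonal _ _).1 hf _ (Submodule.subset_span ⟨i, rfl⟩)
    have htp : 0 < |t| := abs_pos.mpr ht.ne
    have h1 : |t| * ‖(u : H)‖ ^ 2 ≤ ‖B f‖ * ‖(u : H)‖ := by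
      have h2 : (inner ℂ (B f) (u : H)).re
          = (inner ℂ (A u) (u : H)).re - t * ‖(u : H)‖ ^ 2 := by
        rw [← hu', inner_sub_left, inner_smul_left, Complex.conj_ofReal, Complex.sub_re,
          Complex.re_ofReal_mul, inner_self_eq_norm_sq_to_K]
        norm_cast
      have h3 : (inner ℂ (B f) (u : H)).re ≤ ‖B f‖ * ‖(u : H)‖ :=
        (Complex.re_le_norm _).trans (norm_inner_le_norm _ _)
      rw [abs_of_neg ht]
      nlinarith
    have h4 : |t| * ‖(u : H)‖ ≤ ‖B f‖ := by
      rcases (norm_nonneg (u : H)).eq_or_lt with h0 | h0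
      · rw [← h0, mul_zero]; positivity
      · nlinarith
    have h5 : ‖f‖ ≤ ‖B f‖ + |τ| * ‖(u : H)‖ := by
      have : f = B f + (τ : ℂ) • (u : H) := by rw [hBapp, hu]; abel
      calc ‖f‖ = ‖B f + (τ : ℂ) • (u : H)‖ := by rw [← this]
        _ ≤ _ := (norm_add_le _ _).trans (by rw [norm_smul]; simp)
    have h6 : ‖(u : H)‖ ≤ ‖B f‖ / |t| := by rw [le_div_iff₀ htp]; linarith
    calc ‖f‖ ≤ ‖B f‖ + |τ| * (‖B f‖ / |t|) := h5.trans (by gcongr)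
      _ = _ := by ring
  have hclosed : IsClosed ((Sᗮ.map (B : H →ₗ[ℂ] H) : Submodule ℂ H) : Set H) := by
    have hanti : AntilipschitzWith (Real.toNNReal (1 + |τ| / |t|)) (B.comp Sᗮ.subtypeL) := by
      refine AddMonoidHomClass.antilipschitz_of_bound _ fun f => ?_
      rw [Real.coe_toNNReal _ (by positivity)]
      exact hbelow f f.2
    have h := hanti.isClosed_range (B.comp Sᗮ.subtypeL).uniformContinuous
    convert h using 1
    ext x
    simp
  have hrange : IsClosed ((LinearMap.range (B : H →ₗ[ℂ] H) : Submodule ℂ H) : Set H) :=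
    LinearMap.isClosed_range_of_isClosed_map_of_finiteDimensional_quotient hclosed
  -- The range is closed, and by symmetry its orthogonal complement is the kernel of B, which is
  -- trivial.
  have htop : LinearMap.range (B : H →ₗ[ℂ] H) = ⊤ := by
    have : CompleteSpace (LinearMap.range (B : H →ₗ[ℂ] H)) := hrange.completeSpace_coe
    rw [← Submodule.orthogonal_eq_bot_iff, Submodule.eq_bot_iff]
    intro g hg
    apply hBinj
    rw [← inner_self_eq_zero (𝕜 := ℂ), ← hBsym]
    exact (Submodule.mem_orthogonal _ _).1 hg _ ⟨B g, rfl⟩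
  have hker : LinearMap.ker (B : H →ₗ[ℂ] H) = ⊥ := by
    rw [LinearMap.ker_eq_bot']
    exact hBinj
  set E := ContinuousLinearEquiv.ofBijective B hker htop with hE
  have hEB : ∀ f, E f = B f := fun f => rfl
  refine ⟨R.comp (E.symm : H →L[ℂ] H), fun f => ?_, fun u => ?_⟩
  · obtain ⟨u, hu, hu'⟩ := hBu (E.symm f)
    refine ⟨u, hu, ?_⟩
    rw [hu', ← hEB, E.apply_symm_apply]
  · have h1 := hR' u
    obtain ⟨w, hw, hw'⟩ := hBu (A u - (κ : ℂ) • (u : H))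
    have hwu : w = u := Subtype.ext (hw.trans h1)
    subst hwu
    rw [hw', ← hEB]
    simp only [ContinuousLinearMap.comp_apply, ContinuousLinearEquiv.coe_coe,
      ContinuousLinearEquiv.symm_apply_apply]
    exact h1

theorem mem_eigenspace_iff {A : H →ₗ.[ℂ] H} {z : ℂ} {x : H} :
    x ∈ eigenspace A z ↔ ∃ u : A.domain, (u : H) = x ∧ A u = z • (u : H) := by
  simp only [eigenspace, Submodule.mem_map, LinearMap.mem_ker, LinearMap.sub_apply,
    LinearMap.smul_apply, Submodule.subtype_apply, sub_eq_zero]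
  exact exists_congr fun u => and_comm

/-- Orthonormal families of eigenvectors with negative eigenvalues form a negative family. -/
theorem isNegFamily_of_orthonormal {A : H →ₗ.[ℂ] H} {ι : Type*} [Fintype ι] {v : ι → A.domain}
    (hv : Orthonormal ℂ fun i => (v i : H)) {t : ι → ℝ} (ht : ∀ i, t i < 0)
    (hev : ∀ i, A (v i) = (t i : ℂ) • (v i : H)) : IsNegFamily A v := by
  intro c hc
  have h1 : A (∑ i, c i • v i) = ∑ i, ((t i : ℂ) * c i) • (v i : H) := by
    rw [linearPMap_map_sum]
    refine Finset.sum_congr rfl fun i _ => ?_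
    rw [LinearPMap.map_smul, hev, smul_smul, mul_comm]
  have h2 : ((∑ i, c i • v i : A.domain) : H) = ∑ i, c i • (v i : H) := by
    simp
  rw [h1, h2, hv.inner_sum, Complex.re_sum]
  obtain ⟨j, hj⟩ := Function.ne_iff.mp hc
  have hterm : ∀ i, ((starRingEnd ℂ) ((t i : ℂ) * c i) * c i).re = t i * ‖c i‖ ^ 2 := by
    intro i
    rw [map_mul, Complex.conj_ofReal, mul_assoc, Complex.conj_mul', ← Complex.ofReal_pow,
      Complex.re_ofReal_mul, Complex.ofReal_re]
  simp only [hterm]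
  have hj' : 0 < ‖c j‖ := norm_pos_iff.mpr hj
  refine Finset.sum_neg' (fun i _ => ?_) ⟨j, Finset.mem_univ _, ?_⟩
  · exact mul_nonpos_of_nonpos_of_nonneg (ht i).le (by positivity)
  · exact mul_neg_of_neg_of_pos (ht j) (by positivity)

/-- Gram-Schmidt preserves the span, hence stays in W. The cardinal inequality also covers W of
infinite dimension. -/
theorem exists_orthonormal_of_le_rank {W : Submodule ℂ H} {k : ℕ}
    (hk : (k : Cardinal) ≤ Module.rank ℂ W) :
    ∃ w : Fin k → H, Orthonormal ℂ w ∧ ∀ i, w i ∈ W := by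
  obtain ⟨v, hv⟩ := Module.le_rank_iff.1 hk
  have hv' : LinearIndependent ℂ fun i => (v i : H) :=
    hv.map' W.subtype (Submodule.ker_subtype W)
  refine ⟨InnerProductSpace.gramSchmidtNormed ℂ fun i => (v i : H),
    InnerProductSpace.gramSchmidtNormed_orthonormal hv', fun i => ?_⟩
  have h : InnerProductSpace.gramSchmidtNormed ℂ (fun i => (v i : H)) i
      ∈ Submodule.span ℂ (Set.range (InnerProductSpace.gramSchmidtNormed ℂ fun i => (v i : H))) :=
    Submodule.subset_span ⟨i, rfl⟩
  rw [InnerProductSpace.span_gramSchmidtNormed_range,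
    InnerProductSpace.span_gramSchmidt] at h
  exact Submodule.span_le.2 (by rintro _ ⟨j, rfl⟩; exact (v j).2) h

theorem inner_eq_zero_of_eigen {A : H →ₗ.[ℂ] H}
    (hsym : ∀ u v : A.domain, inner ℂ (A u) (v : H) = inner ℂ (u : H) (A v))
    {u v : A.domain} {s t : ℝ} (hst : s ≠ t) (hu : A u = (s : ℂ) • (u : H))
    (hv : A v = (t : ℂ) • (v : H)) : inner ℂ (u : H) (v : H) = 0 := by
  have h := hsym u v
  rw [hu, hv, inner_smul_left, inner_smul_right, Complex.conj_ofReal] at h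
  have h' : ((s : ℂ) - t) * inner ℂ (u : H) (v : H) = 0 := by rw [sub_mul, h, sub_self]
  rcases mul_eq_zero.mp h' with h0 | h0
  · exact absurd (by exact_mod_cast sub_eq_zero.mp h0) hst
  · exact h0

/-- Orthonormal families from different eigenspaces are mutually orthogonal and combine into one
negative family. The free lower bounds k make this usable before any finiteness is known: k = 1
shows that the spectrum is finite, k = n + 1 that each multiplicity is finite, and k equal to the
multiplicity gives the count. -/
theorem sum_le_of_le_rank_eigenspace {A : H →ₗ.[ℂ] H}
    (hsym : ∀ u v : A.domain, inner ℂ (A u) (v : H) = inner ℂ (u : H) (A v)) {n : ℕ}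
    (hn : ∀ (k : ℕ) (v : Fin k → A.domain), IsNegFamily A v → k ≤ n)
    (s : Finset ℝ) (hs : ∀ t ∈ s, t < 0) (k : ℝ → ℕ)
    (hk : ∀ t ∈ s, (k t : Cardinal) ≤ Module.rank ℂ (eigenspace A (t : ℂ))) :
    ∑ t ∈ s, k t ≤ n := by
  have h1 : ∀ t : s, ∃ w : Fin (k t) → A.domain, Orthonormal ℂ (fun i => (w i : H)) ∧
      ∀ i, A (w i) = ((t : ℝ) : ℂ) • (w i : H) := by
    intro t
    obtain ⟨w, hw, hw'⟩ := exists_orthonormal_of_le_rank (hk t t.2)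
    choose u hu hu' using fun i => mem_eigenspace_iff.1 (hw' i)
    refine ⟨u, ?_, hu'⟩
    have : (fun i => (u i : H)) = w := funext hu
    rwa [this]
  choose w hw hev using h1
  have hneg : IsNegFamily A fun x : (Σ t : s, Fin (k t)) => w x.1 x.2 := by
    refine isNegFamily_of_orthonormal (t := fun x => (x.1 : ℝ)) ?_ (fun x => hs _ x.1.2)
      fun x => hev x.1 x.2
    refine ⟨fun x => (hw x.1).1 x.2, ?_⟩
    rintro ⟨t, i⟩ ⟨t', j⟩ hne
    by_cases htt : t = t'
    · subst htt
      exact (hw t).2 fun hij => hne (congrArg (Sigma.mk t) hij)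
    · exact inner_eq_zero_of_eigen hsym (fun h => htt (Subtype.ext h)) (hev t i) (hev t' j)
  have := hn _ _ (hneg.comp_equiv (Fintype.equivFin _).symm)
  rw [Fintype.card_sigma] at this
  simp only [Fintype.card_fin] at this
  rwa [Finset.sum_coe_sort s k] at this

/-- Glazman's lemma: the number of negative eigenvalues is bounded by the maximal dimension of a
subspace on which the form is negative. -/
theorem negEigenvalueCount_le [CompleteSpace H] {A : H →ₗ.[ℂ] H}
    (hsym : ∀ u v : A.domain, inner ℂ (A u) (v : H) = inner ℂ (u : H) (A v))
    {κ : ℝ} (hres : InResolventSet A (κ : ℂ)) {n : ℕ}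
    (hn : ∀ (k : ℕ) (v : Fin k → A.domain), IsNegFamily A v → k ≤ n) :
    negEigenvalueCount A ≤ n := by
  have hev : ∀ t ∈ negSpectrum A, ((1 : ℕ) : Cardinal) ≤ Module.rank ℂ (eigenspace A (t : ℂ)) := by
    rintro t ⟨ht, hnot⟩
    have : ∃ u : A.domain, A u = (t : ℂ) • (u : H) ∧ (u : H) ≠ 0 := by
      by_contra! h
      exact hnot (inResolventSet_of_forall_ne hsym hres hn ht h)
    obtain ⟨u, hu, hu0⟩ := this
    rw [Nat.cast_one, Cardinal.one_le_iff_ne_zero, ne_eq, rank_zero_iff]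
    intro hsub
    apply hu0
    have h := hsub.elim (⟨u, mem_eigenspace_iff.2 ⟨u, rfl, hu⟩⟩ : eigenspace A (t : ℂ)) 0
    exact congrArg Subtype.val h
  have hfin : (negSpectrum A).Finite := by
    by_contra hinf
    obtain ⟨s, hs, hcard⟩ := Set.Infinite.exists_subset_card_eq hinf (n + 1)
    have h := sum_le_of_le_rank_eigenspace hsym hn s (fun t ht => (hs ht).1) (fun _ => 1)
      fun t ht => hev t (hs ht)
    simp [hcard] at h
  have hneg : ∀ t ∈ hfin.toFinset, t < 0 := fun t ht => ((Set.Finite.mem_toFinset _).1 ht).1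
  have hrank : ∀ t ∈ hfin.toFinset, Module.rank ℂ (eigenspace A (t : ℂ)) < Cardinal.aleph0 := by
    intro t ht
    by_contra! h
    have h' := sum_le_of_le_rank_eigenspace hsym hn {t}
      (fun t' ht' => by rw [Finset.mem_singleton.1 ht']; exact hneg t ht) (fun _ => n + 1)
      fun t' ht' => by
        rw [Finset.mem_singleton.1 ht']
        exact (Cardinal.natCast_lt_aleph0.le).trans h
    simp at h'
  rw [negEigenvalueCount, dif_pos hfin]
  have heq : ∀ t ∈ hfin.toFinset, Cardinal.toENat (Module.rank ℂ (eigenspace A (t : ℂ)))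
      = ((Cardinal.toNat (Module.rank ℂ (eigenspace A (t : ℂ))) : ℕ) : ℕ∞) := by
    intro t ht
    conv_lhs => rw [← Cardinal.cast_toNat_of_lt_aleph0 (hrank t ht)]
    simp
  rw [Finset.sum_congr rfl heq, ← Nat.cast_sum]
  exact_mod_cast sum_le_of_le_rank_eigenspace hsym hn hfin.toFinset hneg
    (fun t => Cardinal.toNat (Module.rank ℂ (eigenspace A (t : ℂ))))
    fun t ht => (Cardinal.cast_toNat_of_lt_aleph0 (hrank t ht)).le

end AbstractCounting

/-! ### Negative families and Hilbert-Schmidt norms -/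

section AbstractForm

variable {H : Type*} [NormedAddCommGroup H] [InnerProductSpace ℂ H]

/-- If the form of `A` dominates `β ‖J u‖² - α ‖Y u‖²` with `J` injective, and `Y J⁻¹` has squared
Hilbert-Schmidt norm at most `S`, then negative families have at most `α S / β` members. -/
theorem IsNegFamily.mul_card_le {A : H →ₗ.[ℂ] H} {J Y : H →L[ℂ] H}
    (hJ : Function.Injective J) {α β S : ℝ} (hα : 0 ≤ α)
    (hform : ∀ u : A.domain,
      β * ‖J u‖ ^ 2 - α * ‖Y u‖ ^ 2 ≤ (inner ℂ (A u) (u : H)).re)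
    (hS : ∀ (k : ℕ) (u : Fin k → H), Orthonormal ℂ (fun i => J (u i)) → ∑ i, ‖Y (u i)‖ ^ 2 ≤ S)
    {k : ℕ} {v : Fin k → A.domain} (hv : IsNegFamily A v) : β * k ≤ α * S := by
  have hlin : LinearIndependent ℂ fun i => J (v i : H) := by
    rw [Fintype.linearIndependent_iff]
    intro c hc
    by_contra! h
    have hc0 : c ≠ 0 := by
      rintro rfl
      obtain ⟨i, hi⟩ := h
      exact hi rfl
    have h0 : ((∑ i, c i • v i : A.domain) : H) = 0 := by
      apply hJ
      rw [map_zero, ← hc]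
      simp
    have := hv c hc0
    rw [h0, inner_zero_right, Complex.zero_re] at this
    exact lt_irrefl _ this
  have hrank : (k : Cardinal)
      ≤ Module.rank ℂ (Submodule.span ℂ (Set.range fun i => J (v i : H))) :=
    Module.le_rank_iff.2 ⟨_, linearIndependent_span hlin⟩
  -- Orthonormalising after applying J gives combinations w i of the family with ‖J (w i)‖ = 1.
  -- Negativity of the form then forces α‖Y (w i)‖² ≥ β for each i, and summation bounds k.
  obtain ⟨e, he, hemem⟩ := exists_orthonormal_of_le_rank hrank
  choose c hc using fun i => (Submodule.mem_span_range_iff_exists_fun ℂ).1 (hemem i)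
  set w : Fin k → A.domain := fun i => ∑ j, c i j • v j with hw
  have hJw : ∀ i, J (w i : H) = e i := by
    intro i
    rw [← hc i, hw]
    simp
  have hterm : ∀ i, β ≤ α * ‖Y (w i)‖ ^ 2 := by
    intro i
    have hci : c i ≠ 0 := by
      intro h0
      have := he.ne_zero i
      apply this
      rw [← hc i, h0]
      simp
    have h1 := hv (c i) hci
    have h2 := hform (w i)
    rw [hJw, he.1 i] at h2
    have h3 : (inner ℂ (A (w i)) (w i : H)).re < 0 := h1
    linarith
  have hsum := hS k (fun i => (w i : H)) (by simpa only [hJw] using he)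
  calc β * k = ∑ _i : Fin k, β := by simp [mul_comm]
    _ ≤ ∑ i, α * ‖Y (w i)‖ ^ 2 := Finset.sum_le_sum fun i _ => hterm i
    _ = α * ∑ i, ‖Y (w i)‖ ^ 2 := by rw [Finset.mul_sum]
    _ ≤ α * S := by gcongr

end AbstractForm

/-! ### Bounded multiplication operators -/

theorem mulOp_apply_ae (m : R3 → ℝ) (u : (mulOp m).domain) :
    mulOp m u =ᵐ[volume] fun x => (m x : ℂ) * (u : L2R3) x :=
  coeFn_mulValue m u

theorem mulDomain_eq_top {m : R3 → ℝ} {c : ℝ} (hm : AEStronglyMeasurable m volume)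
    (hc : ∀ᵐ x : R3, |m x| ≤ c) : mulDomain m = ⊤ := by
  rw [Submodule.eq_top_iff']
  intro u
  refine MemLp.of_le_mul (c := c) (Lp.memLp u)
    ((Complex.continuous_ofReal.comp_aestronglyMeasurable hm).mul
      (Lp.aestronglyMeasurable u)) ?_
  filter_upwards [hc] with x hx
  rw [norm_mul, Complex.norm_real, Real.norm_eq_abs]
  gcongr

theorem norm_mulOp_le {m : R3 → ℝ} {c : ℝ} (hc : ∀ᵐ x : R3, |m x| ≤ c) (u : (mulOp m).domain) :
    ‖mulOp m u‖ ≤ c * ‖(u : L2R3)‖ := by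
  refine Lp.norm_le_mul_norm_of_ae_le_mul ?_
  filter_upwards [hc, mulOp_apply_ae m u] with x hx hu
  rw [hu, norm_mul, Complex.norm_real, Real.norm_eq_abs]
  gcongr

/-- Multiplication by a bounded function as a bounded operator. -/
def boundedMul (m : R3 → ℝ) (c : ℝ) (hm : AEStronglyMeasurable m volume)
    (hc : ∀ᵐ x : R3, |m x| ≤ c) : L2R3 →L[ℂ] L2R3 :=
  LinearMap.mkContinuous
    ((mulOp m).toFun ∘ₗ LinearMap.id.codRestrict (mulOp m).domain fun u => by
      change _ ∈ mulDomain m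
      rw [mulDomain_eq_top hm hc]
      exact Submodule.mem_top) c fun u => norm_mulOp_le hc _

section BoundedMul

variable {m : R3 → ℝ} {c : ℝ} {hm : AEStronglyMeasurable m volume} {hc : ∀ᵐ x : R3, |m x| ≤ c}

theorem boundedMul_ae (u : L2R3) :
    boundedMul m c hm hc u =ᵐ[volume] fun x => (m x : ℂ) * u x :=
  coeFn_mulValue m _

theorem boundedMul_eq_mulOp (u : (mulOp m).domain) :
    boundedMul m c hm hc (u : L2R3) = mulOp m u := by
  apply Lp.ext
  filter_upwards [boundedMul_ae (hm := hm) (hc := hc) (u : L2R3), mulOp_apply_ae m u] with x h1 h2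
  rw [h1, h2]

theorem norm_boundedMul_le (hc0 : 0 ≤ c) : ‖boundedMul m c hm hc‖ ≤ c :=
  LinearMap.mkContinuous_norm_le _ hc0 _

theorem boundedMul_injective (h0 : ∀ᵐ x : R3, m x ≠ 0) :
    Function.Injective (boundedMul m c hm hc) := by
  rw [injective_iff_map_eq_zero]
  intro u hu
  apply Lp.ext
  have h1 := boundedMul_ae (hm := hm) (hc := hc) u
  rw [hu] at h1
  filter_upwards [h1, h0, Lp.coeFn_zero ℂ 2 (volume : Measure R3)] with x hx hx0 hz
  rw [hz, Pi.zero_apply] at hx ⊢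
  exact (mul_eq_zero.mp hx.symm).resolve_left (by exact_mod_cast hx0)

end BoundedMul

theorem norm_sq_eq_integral (u : L2R3) : ‖u‖ ^ 2 = ∫ x, ‖u x‖ ^ 2 := by
  have h : ∀ x, inner ℂ (u x) (u x) = ((‖u x‖ ^ 2 : ℝ) : ℂ) := by
    intro x
    rw [inner_self_eq_norm_sq_to_K]
    norm_cast
  calc ‖u‖ ^ 2 = (inner ℂ u u).re := (inner_self_eq_norm_sq (𝕜 := ℂ) u).symm
    _ = _ := by
      rw [L2.inner_def]
      simp only [h]
      rw [integral_complex_ofReal, Complex.ofReal_re]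

theorem integrable_norm_sq (u : L2R3) : Integrable (fun x => ‖u x‖ ^ 2) volume :=
  (memLp_two_iff_integrable_sq_norm (Lp.aestronglyMeasurable u)).1 (Lp.memLp u)

theorem inner_mulOp_ae (m : R3 → ℝ) (u : (mulOp m).domain) :
    (fun x => inner ℂ (mulOp m u x) ((u : L2R3) x))
      =ᵐ[volume] fun x => ((m x * ‖(u : L2R3) x‖ ^ 2 : ℝ) : ℂ) := by
  filter_upwards [mulOp_apply_ae m u] with x hx
  rw [hx, RCLike.inner_apply, map_mul, Complex.conj_ofReal]
  rw [mul_left_comm, Complex.mul_conj']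
  push_cast
  ring

theorem integrable_mulOp_form (m : R3 → ℝ) (u : (mulOp m).domain) :
    Integrable (fun x => m x * ‖(u : L2R3) x‖ ^ 2) volume := by
  have h := ((L2.integrable_inner (𝕜 := ℂ) (mulOp m u) (u : L2R3)).congr (inner_mulOp_ae m u)).re
  exact h.congr (Filter.Eventually.of_forall fun x => Complex.ofReal_re _)

theorem re_inner_mulOp (m : R3 → ℝ) (u : (mulOp m).domain) :
    (inner ℂ (mulOp m u) (u : L2R3)).re = ∫ x, m x * ‖(u : L2R3) x‖ ^ 2 := by
  rw [L2.inner_def, integral_congr_ae (inner_mulOp_ae m u), integral_complex_ofReal, Complex.ofReal_re]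

theorem inner_mulOp_comm (m : R3 → ℝ) (u v : (mulOp m).domain) :
    inner ℂ (mulOp m u) (v : L2R3) = inner ℂ (u : L2R3) (mulOp m v) := by
  rw [L2.inner_def, L2.inner_def]
  refine integral_congr_ae ?_
  filter_upwards [mulOp_apply_ae m u, mulOp_apply_ae m v] with x h1 h2
  simp only [h1, h2, RCLike.inner_apply, map_mul, Complex.conj_ofReal]
  ring

theorem norm_boundedMul_sq {m : R3 → ℝ} {c : ℝ} {hm : AEStronglyMeasurable m volume}
    {hc : ∀ᵐ x : R3, |m x| ≤ c} (u : L2R3) :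
    ‖boundedMul m c hm hc u‖ ^ 2 = ∫ x, m x ^ 2 * ‖u x‖ ^ 2 := by
  rw [norm_sq_eq_integral]
  refine integral_congr_ae ?_
  filter_upwards [boundedMul_ae (hm := hm) (hc := hc) u] with x hx
  simp only [hx, norm_mul, mul_pow, Complex.norm_real, Real.norm_eq_abs, sq_abs]

theorem integrable_boundedMul_sq {m : R3 → ℝ} {c : ℝ} (hm : AEStronglyMeasurable m volume)
    (hc : ∀ᵐ x : R3, |m x| ≤ c) (u : L2R3) :
    Integrable (fun x => m x ^ 2 * ‖u x‖ ^ 2) volume := by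
  refine (integrable_norm_sq (boundedMul m c hm hc u)).congr ?_
  filter_upwards [boundedMul_ae (hm := hm) (hc := hc) u] with x hx
  simp only [hx, norm_mul, mul_pow, Complex.norm_real, Real.norm_eq_abs, sq_abs]

/-! ### Fourier multipliers -/

/-- The Plancherel isometry of `L²(ℝ³)`. -/
abbrev plancherel : L2R3 ≃ₗᵢ[ℂ] L2R3 := Lp.fourierTransformₗᵢ R3 ℂ

/-- The symbol of `h(i∇)` in the frequency variable of the Fourier transform. -/
abbrev freqSymbol (h : R3 → ℝ) (w : R3) : ℝ := h (-(2 * Real.pi) • w)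

theorem mem_symbolOp_domain {h : R3 → ℝ} {u : L2R3} :
    u ∈ (symbolOp h).domain ↔ plancherel u ∈ (mulOp (freqSymbol h)).domain := Iff.rfl

theorem symbolOp_apply (h : R3 → ℝ) (u : (symbolOp h).domain) :
    symbolOp h u = plancherel.symm (mulOp (freqSymbol h) ⟨plancherel u, mem_symbolOp_domain.1 u.2⟩) := rfl

theorem inner_symbolOp_comm (h : R3 → ℝ) (u v : (symbolOp h).domain) :
    inner ℂ (symbolOp h u) (v : L2R3) = inner ℂ (u : L2R3) (symbolOp h v) := by
  rw [symbolOp_apply, symbolOp_apply, ← plancherel.inner_map_map,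
    ← plancherel.inner_map_map (u : L2R3), plancherel.apply_symm_apply,
    plancherel.apply_symm_apply]
  exact inner_mulOp_comm _ ⟨plancherel u, u.2⟩ ⟨plancherel v, v.2⟩

theorem re_inner_symbolOp (h : R3 → ℝ) (u : (symbolOp h).domain) :
    (inner ℂ (symbolOp h u) (u : L2R3)).re
      = ∫ w, freqSymbol h w * ‖plancherel (u : L2R3) w‖ ^ 2 := by
  rw [symbolOp_apply, ← plancherel.inner_map_map, plancherel.apply_symm_apply]
  exact re_inner_mulOp _ ⟨plancherel u, u.2⟩

/-- The conjugate `U⁻¹ R U` of a bounded operator by a unitary operator. -/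
def unitaryConj {H : Type*} [NormedAddCommGroup H] [InnerProductSpace ℂ H] (U : H ≃ₗᵢ[ℂ] H)
    (R : H →L[ℂ] H) : H →L[ℂ] H :=
  (U.symm : H →L[ℂ] H) ∘L R ∘L (U : H →L[ℂ] H)

theorem unitaryConj_apply {H : Type*} [NormedAddCommGroup H] [InnerProductSpace ℂ H]
    (U : H ≃ₗᵢ[ℂ] H) (R : H →L[ℂ] H) (f : H) : unitaryConj U R f = U.symm (R (U f)) := rfl

theorem norm_unitaryConj_le {H : Type*} [NormedAddCommGroup H] [InnerProductSpace ℂ H]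
    (U : H ≃ₗᵢ[ℂ] H) (R : H →L[ℂ] H) : ‖unitaryConj U R‖ ≤ ‖R‖ := by
  refine ContinuousLinearMap.opNorm_le_bound _ (norm_nonneg R) fun u => ?_
  rw [unitaryConj_apply, U.symm.norm_map]
  exact (R.le_opNorm _).trans (by rw [U.norm_map])

/-- The bounded Fourier multiplier `𝓕⁻¹ m 𝓕`. -/
def fourierMul (m : R3 → ℝ) (c : ℝ) (hm : AEStronglyMeasurable m volume)
    (hc : ∀ᵐ x : R3, |m x| ≤ c) : L2R3 →L[ℂ] L2R3 :=
  unitaryConj plancherel (boundedMul m c hm hc)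

section FourierMul

variable {m : R3 → ℝ} {c : ℝ} {hm : AEStronglyMeasurable m volume} {hc : ∀ᵐ x : R3, |m x| ≤ c}

theorem fourierMul_apply (u : L2R3) :
    fourierMul m c hm hc u = plancherel.symm (boundedMul m c hm hc (plancherel u)) :=
  unitaryConj_apply _ _ u

/-- The kinetic form controls the part of `u` away from where the multiplier equals one. -/
theorem norm_sub_fourierMul_sq_le {h : R3 → ℝ} {C : ℝ}
    (hle : ∀ w, C * (1 - m w) ^ 2 ≤ freqSymbol h w) (u : (symbolOp h).domain) :
    C * ‖(u : L2R3) - fourierMul m c hm hc u‖ ^ 2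
      ≤ (inner ℂ (symbolOp h u) (u : L2R3)).re := by
  have h1 : ‖(u : L2R3) - fourierMul m c hm hc u‖
      = ‖plancherel (u : L2R3) - boundedMul m c hm hc (plancherel u)‖ := by
    rw [← plancherel.norm_map, map_sub, fourierMul_apply, plancherel.apply_symm_apply]
  have h2 : ∀ᵐ w, ‖(plancherel (u : L2R3) - boundedMul m c hm hc (plancherel u) : L2R3) w‖ ^ 2
      = (1 - m w) ^ 2 * ‖plancherel (u : L2R3) w‖ ^ 2 := by
    filter_upwards [boundedMul_ae (hm := hm) (hc := hc) (plancherel (u : L2R3)),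
      Lp.coeFn_sub (plancherel (u : L2R3)) (boundedMul m c hm hc (plancherel u))] with w h3 h4
    rw [h4, Pi.sub_apply, h3, ← one_sub_mul, norm_mul, mul_pow]
    rw [show (1 - (m w : ℂ)) = ((1 - m w : ℝ) : ℂ) by push_cast; rfl, Complex.norm_real,
      Real.norm_eq_abs, sq_abs]
  rw [h1, norm_sq_eq_integral, re_inner_symbolOp, ← integral_const_mul]
  refine integral_mono_ae ((integrable_norm_sq _).const_mul C)
    (integrable_mulOp_form (freqSymbol h) ⟨plancherel u, u.2⟩) ?_
  filter_upwards [h2] with w hw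
  simp only [hw]
  rw [← mul_assoc]
  gcongr
  exact hle w

end FourierMul

/-! ### Self-adjointness of a nonnegative Fourier multiplier plus a bounded potential -/

theorem sub_apply_eq (h v : R3 → ℝ) (u : (symbolOp h - mulOp v).domain) :
    (symbolOp h - mulOp v) u = symbolOp h ⟨u, u.2.1⟩ - mulOp v ⟨u, u.2.2⟩ := rfl

theorem inner_sub_comm (h v : R3 → ℝ) (u w : (symbolOp h - mulOp v).domain) :
    inner ℂ ((symbolOp h - mulOp v) u) (w : L2R3)
      = inner ℂ (u : L2R3) ((symbolOp h - mulOp v) w) := by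
  rw [sub_apply_eq, sub_apply_eq, inner_sub_left, inner_sub_right]
  congr 1
  · exact inner_symbolOp_comm h ⟨u, u.2.1⟩ ⟨w, w.2.1⟩
  · exact inner_mulOp_comm v ⟨u, u.2.2⟩ ⟨w, w.2.2⟩

/-- The inverse is multiplication by (h + κ)⁻¹ ≤ κ⁻¹; its range lies in the maximal domain because
h/(h + κ) ≤ 1. -/
theorem exists_inverse_mulOp {h : R3 → ℝ} (hmeas : Measurable h) (h0 : ∀ ξ, 0 ≤ h ξ)
    {κ : ℝ} (hκ : 0 < κ) :
    ∃ R : L2R3 →L[ℂ] L2R3, ‖R‖ ≤ κ⁻¹ ∧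
      (∀ f, ∃ u : (mulOp h).domain, (u : L2R3) = R f ∧ mulOp h u + (κ : ℂ) • (u : L2R3) = f) ∧
      ∀ u : (mulOp h).domain, R (mulOp h u + (κ : ℂ) • (u : L2R3)) = u := by
  have hpos : ∀ w, 0 < h w + κ := fun w => add_pos_of_nonneg_of_pos (h0 _) hκ
  have hm : AEStronglyMeasurable (fun w => (h w + κ)⁻¹) (volume : Measure R3) :=
    (hmeas.add_const κ).inv.aestronglyMeasurable
  have hc : ∀ᵐ w : R3, |(h w + κ)⁻¹| ≤ κ⁻¹ := by
    refine Filter.Eventually.of_forall fun w => ?_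
    rw [abs_of_pos (inv_pos.2 (hpos w))]
    exact inv_anti₀ hκ (by linarith [h0 w])
  refine ⟨boundedMul _ κ⁻¹ hm hc, norm_boundedMul_le (by positivity), fun f => ?_, fun u => ?_⟩
  · have hae := boundedMul_ae (hm := hm) (hc := hc) f
    have hdom : boundedMul _ κ⁻¹ hm hc f ∈ (mulOp h).domain := by
      refine MemLp.of_le_mul (c := 1) (Lp.memLp f)
        ((Complex.continuous_ofReal.comp_aestronglyMeasurable hmeas.aestronglyMeasurable).mul
          (Lp.aestronglyMeasurable _)) ?_
      filter_upwards [hae] with w hw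
      rw [hw, ← mul_assoc, norm_mul, ← Complex.ofReal_mul, Complex.norm_real]
      gcongr
      rw [Real.norm_eq_abs, abs_of_nonneg (mul_nonneg (h0 _) (inv_pos.2 (hpos w)).le),
        ← div_eq_mul_inv, div_le_one (hpos w)]
      linarith
    refine ⟨⟨_, hdom⟩, rfl, ?_⟩
    apply Lp.ext
    filter_upwards [mulOp_apply_ae h ⟨_, hdom⟩, hae,
      Lp.coeFn_add (mulOp h ⟨_, hdom⟩) ((κ : ℂ) • boundedMul _ κ⁻¹ hm hc f),
      Lp.coeFn_smul (κ : ℂ) (boundedMul _ κ⁻¹ hm hc f)] with w h4 h5 h6 h7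
    rw [h6, Pi.add_apply, h4, h7, Pi.smul_apply, smul_eq_mul, ← add_mul, h5, ← mul_assoc,
      ← Complex.ofReal_add, ← Complex.ofReal_mul, mul_inv_cancel₀ (hpos w).ne',
      Complex.ofReal_one, one_mul]
  · apply Lp.ext
    filter_upwards [boundedMul_ae (hm := hm) (hc := hc) (mulOp h u + (κ : ℂ) • (u : L2R3)),
      mulOp_apply_ae h u, Lp.coeFn_add (mulOp h u) ((κ : ℂ) • (u : L2R3)),
      Lp.coeFn_smul (κ : ℂ) (u : L2R3)] with w h1 h2 h3 h4
    rw [h1, h3, Pi.add_apply, h2, h4, Pi.smul_apply, smul_eq_mul, ← add_mul, ← mul_assoc,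
      ← Complex.ofReal_add, ← Complex.ofReal_mul, inv_mul_cancel₀ (hpos w).ne',
      Complex.ofReal_one, one_mul]

theorem exists_inverse_symbolOp {h : R3 → ℝ} (hmeas : Measurable h) (h0 : ∀ ξ, 0 ≤ h ξ)
    {κ : ℝ} (hκ : 0 < κ) :
    ∃ R : L2R3 →L[ℂ] L2R3, ‖R‖ ≤ κ⁻¹ ∧
      (∀ f, ∃ u : (symbolOp h).domain, (u : L2R3) = R f ∧
        symbolOp h u + (κ : ℂ) • (u : L2R3) = f) ∧
      ∀ u : (symbolOp h).domain, R (symbolOp h u + (κ : ℂ) • (u : L2R3)) = u := by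
  have hfm : Measurable (freqSymbol h) := hmeas.comp (measurable_const_smul _)
  obtain ⟨R, hRn, hR, hR'⟩ := exists_inverse_mulOp hfm (fun w => h0 _) hκ
  refine ⟨unitaryConj plancherel R, (norm_unitaryConj_le _ _).trans hRn, fun f => ?_, fun u => ?_⟩
  · obtain ⟨w, hw, hw'⟩ := hR (plancherel f)
    have h1 : plancherel (plancherel.symm (w : L2R3)) = w := plancherel.apply_symm_apply _
    have hdom : plancherel.symm (w : L2R3) ∈ (symbolOp h).domain := by
      rw [mem_symbolOp_domain, h1]
      exact w.2
    refine ⟨⟨_, hdom⟩, ?_, ?_⟩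
    · rw [unitaryConj_apply, ← hw]
    · have h2 : mulOp (freqSymbol h) ⟨plancherel (plancherel.symm (w : L2R3)),
          mem_symbolOp_domain.1 hdom⟩ = mulOp (freqSymbol h) w := by
        congr 1
        exact Subtype.ext h1
      rw [symbolOp_apply, h2, ← map_smul, ← map_add, hw', plancherel.symm_apply_apply]
  · rw [unitaryConj_apply, map_add, map_smul, symbolOp_apply, plancherel.apply_symm_apply,
      hR' ⟨plancherel u, mem_symbolOp_domain.1 u.2⟩, plancherel.symm_apply_apply]

/-- Neumann series: with R the inverse of h(i∇) + c + 1, the shifted operator applied to R is 1 -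
vR, and ‖vR‖ ≤ c/(c + 1) < 1. One resolvent point is all that Glazman's lemma needs. -/
theorem inResolventSet_sub {h v : R3 → ℝ} (hmeas : Measurable h) (h0 : ∀ ξ, 0 ≤ h ξ)
    {c : ℝ} (hc0 : 0 ≤ c) (hv : AEStronglyMeasurable v volume) (hc : ∀ᵐ x : R3, |v x| ≤ c) :
    InResolventSet (symbolOp h - mulOp v) ((-(c + 1) : ℝ) : ℂ) := by
  obtain ⟨R, hRn, hR, hR'⟩ := exists_inverse_symbolOp hmeas h0 (by positivity : 0 < c + 1)
  set T : L2R3 →L[ℂ] L2R3 := boundedMul v c hv hc ∘L R with hT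
  have hTn : ‖T‖ < 1 := by
    calc ‖T‖ ≤ ‖boundedMul v c hv hc‖ * ‖R‖ := ContinuousLinearMap.opNorm_comp_le _ _
      _ ≤ c * (c + 1)⁻¹ := by
        gcongr
        exact norm_boundedMul_le hc0
      _ < 1 := by
        rw [← div_eq_mul_inv, div_lt_one (by positivity)]
        linarith
  set G : (L2R3 →L[ℂ] L2R3)ˣ := Units.oneSub T hTn with hG
  have hGl : ∀ f, ((G⁻¹ : (L2R3 →L[ℂ] L2R3)ˣ) : L2R3 →L[ℂ] L2R3) (f - T f) = f := fun f =>
    congrArg (fun L : L2R3 →L[ℂ] L2R3 => L f) G.inv_mul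
  have hGr : ∀ f, ((G⁻¹ : (L2R3 →L[ℂ] L2R3)ˣ) : L2R3 →L[ℂ] L2R3) f
      - T (((G⁻¹ : (L2R3 →L[ℂ] L2R3)ˣ) : L2R3 →L[ℂ] L2R3) f) = f := fun f =>
    congrArg (fun L : L2R3 →L[ℂ] L2R3 => L f) G.mul_inv
  have htop : ∀ u : L2R3, u ∈ (mulOp v).domain := fun u => by
    change u ∈ mulDomain v
    rw [mulDomain_eq_top hv hc]
    exact Submodule.mem_top
  refine ⟨R ∘L ((G⁻¹ : (L2R3 →L[ℂ] L2R3)ˣ) : L2R3 →L[ℂ] L2R3), fun f => ?_, fun u => ?_⟩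
  · obtain ⟨u, hu, hu'⟩ := hR (((G⁻¹ : (L2R3 →L[ℂ] L2R3)ˣ) : L2R3 →L[ℂ] L2R3) f)
    refine ⟨⟨u, u.2, htop u⟩, hu, ?_⟩
    rw [sub_apply_eq, ← boundedMul_eq_mulOp (hm := hv) (hc := hc)]
    have h1 := hGr f
    rw [hT, ContinuousLinearMap.comp_apply, ← hu, ← hu'] at h1
    conv_rhs => rw [← h1]
    push_cast
    module
  · obtain ⟨⟨u, hu1, hu2⟩, rfl⟩ : ∃ w : (symbolOp h - mulOp v).domain, w = u := ⟨u, rfl⟩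
    have h1 := hR' ⟨u, hu1⟩
    set g : L2R3 := symbolOp h ⟨u, hu1⟩ + ((c + 1 : ℝ) : ℂ) • u with hg
    have h2 : (symbolOp h - mulOp v) ⟨u, hu1, hu2⟩ - ((-(c + 1) : ℝ) : ℂ) • u = g - T g := by
      rw [hT, ContinuousLinearMap.comp_apply, h1, sub_apply_eq,
        ← boundedMul_eq_mulOp (hm := hv) (hc := hc), hg]
      push_cast
      module
    simp only at h1 ⊢
    rw [h2, ContinuousLinearMap.comp_apply, hGl, h1]

/-- Lower bound of the form of `h(i∇) - v` when `-v ≥ β j² - α` on `B` and `-v ≥ β j²` off `B`. -/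
theorem form_lower_bound {h v j m : R3 → ℝ} {α β c d : ℝ} {B : Set R3} (hα : 0 ≤ α)
    (hmm : AEStronglyMeasurable m volume) (hmc : ∀ᵐ x : R3, |m x| ≤ c)
    (hjm : AEStronglyMeasurable j volume) (hjc : ∀ᵐ x : R3, |j x| ≤ d)
    (hBm : AEStronglyMeasurable (B.indicator fun _ => (1 : ℝ)) (volume : Measure R3))
    (hBc : ∀ᵐ x : R3, |B.indicator (fun _ => (1 : ℝ)) x| ≤ 1)
    (hle : ∀ w, 2 * α * (1 - m w) ^ 2 ≤ freqSymbol h w)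
    (hv : ∀ᵐ x : R3, β * j x ^ 2 - α * B.indicator (fun _ => (1 : ℝ)) x ≤ -v x)
    (u : (symbolOp h - mulOp v).domain) :
    β * ‖boundedMul j d hjm hjc u‖ ^ 2
        - 2 * α * ‖(boundedMul _ 1 hBm hBc ∘L fourierMul m c hmm hmc) u‖ ^ 2
      ≤ (inner ℂ ((symbolOp h - mulOp v) u) (u : L2R3)).re := by
  set X := boundedMul _ 1 hBm hBc with hX
  set P := fourierMul m c hmm hmc with hP
  have h1 : 2 * α * ‖(u : L2R3) - P u‖ ^ 2
      ≤ (inner ℂ (symbolOp h ⟨u, u.2.1⟩) (u : L2R3)).re :=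
    norm_sub_fourierMul_sq_le hle ⟨u, u.2.1⟩
  have h2 : β * ‖boundedMul j d hjm hjc u‖ ^ 2 - α * ‖X u‖ ^ 2
      ≤ -(inner ℂ (mulOp v ⟨u, u.2.2⟩) (u : L2R3)).re := by
    have h3 := re_inner_mulOp v ⟨u, u.2.2⟩
    have h4 := integrable_mulOp_form v ⟨u, u.2.2⟩
    simp only at h3 h4
    rw [h3, norm_boundedMul_sq, hX, norm_boundedMul_sq, ← integral_neg, ← integral_const_mul,
      ← integral_const_mul, ← integral_sub ((integrable_boundedMul_sq hjm hjc _).const_mul _)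
        ((integrable_boundedMul_sq hBm hBc _).const_mul _)]
    refine integral_mono_ae (((integrable_boundedMul_sq hjm hjc _).const_mul _).sub
        ((integrable_boundedMul_sq hBm hBc _).const_mul _)) h4.neg ?_
    filter_upwards [hv] with x hx
    have h5 : B.indicator (fun _ => (1 : ℝ)) x ^ 2 = B.indicator (fun _ => (1 : ℝ)) x := by
      by_cases hxB : x ∈ B <;> simp [hxB]
    simp only [h5]
    have h6 : 0 ≤ ‖(u : L2R3) x‖ ^ 2 := by positivity
    nlinarith
  have h7 : ‖X u‖ ≤ ‖(u : L2R3) - P u‖ + ‖X (P u)‖ := by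
    have h8 : X u = X ((u : L2R3) - P u) + X (P u) := by rw [← map_add, sub_add_cancel]
    rw [h8]
    refine (norm_add_le _ _).trans ?_
    gcongr
    simpa using X.le_of_opNorm_le (norm_boundedMul_le zero_le_one) ((u : L2R3) - P u)
  -- The factor 2 here is why the kinetic bound is assumed with 2α: the terms in ‖u - Pu‖² cancel
  -- exactly.
  have h9 : ‖X u‖ ^ 2 ≤ 2 * ‖(u : L2R3) - P u‖ ^ 2 + 2 * ‖X (P u)‖ ^ 2 := by
    have := pow_le_pow_left₀ (norm_nonneg _) h7 2
    nlinarith [sq_nonneg (‖(u : L2R3) - P u‖ - ‖X (P u)‖)]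
  have h10 := mul_le_mul_of_nonneg_left h9 hα
  rw [sub_apply_eq, inner_sub_left, Complex.sub_re, ContinuousLinearMap.comp_apply]
  linarith

/-! ### Hilbert-Schmidt bound for localized Fourier multipliers -/

open scoped SchwartzMap

theorem memLp_conj_translate (φ : 𝓢(R3, ℂ)) (y : R3) :
    MemLp (fun z => (starRingEnd ℂ) (φ (z - y))) 2 (volume : Measure R3) :=
  ((φ.memLp 2 volume).comp_measurePreserving (measurePreserving_sub_right volume y)).star

/-- The function `z ↦ conj (φ (z - y))` in `L²`. -/
def conjTranslate (φ : 𝓢(R3, ℂ)) (y : R3) : L2R3 := (memLp_conj_translate φ y).toLp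

theorem inner_conjTranslate (φ : 𝓢(R3, ℂ)) (y : R3) (u : L2R3) :
    inner ℂ (conjTranslate φ y) u = ∫ z, φ (z - y) * u z := by
  rw [L2.inner_def]
  refine integral_congr_ae ?_
  filter_upwards [MemLp.coeFn_toLp (memLp_conj_translate φ y)] with z hz
  rw [conjTranslate, hz, RCLike.inner_apply, Complex.conj_conj, mul_comm]

theorem fourier_modulate (φ : R3 → ℂ) (y z : R3) :
    𝓕 (fun v => Real.fourierChar (inner ℝ v y) • φ v) z = 𝓕 φ (z - y) := by
  rw [Real.fourier_eq, Real.fourier_eq]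
  congr 1
  funext v
  rw [smul_smul, ← AddChar.map_add_eq_mul, inner_sub_right]
  congr 2
  ring

/-- The left side is the inverse transform of φ · 𝓕 f at y. Moving the transform from f onto the
modulated φ turns the modulation into a translation, which exhibits the convolution kernel. -/
theorem integral_fourier_mul_eq_translate (φ f : 𝓢(R3, ℂ)) (y : R3) :
    ∫ v, Real.fourierChar (inner ℝ v y) • (φ v * 𝓕 f v) = ∫ z, 𝓕 φ (z - y) * f z := by
  have hint : Integrable (fun v => Real.fourierChar (inner ℝ v y) • φ v) volume := by
    have h := (Real.fourierIntegral_convergent_iff (-y)).2 (φ.integrable (μ := (volume : Measure R3)))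
    simpa using h
  have h := VectorFourier.integral_fourierIntegral_smul_eq_flip (L := innerₗ R3)
    (μ := (volume : Measure R3)) (ν := (volume : Measure R3))
    Real.continuous_fourierChar continuous_inner hint f.integrable
  have h1 : ∀ z, VectorFourier.fourierIntegral Real.fourierChar volume (innerₗ R3)
      (fun v => Real.fourierChar (inner ℝ v y) • φ v) z = 𝓕 φ (z - y) := by
    intro z
    rw [SchwartzMap.fourier_coe]
    exact fourier_modulate φ y z
  have h2 : ∀ v, VectorFourier.fourierIntegral Real.fourierChar volume (innerₗ R3).flip f v
      = 𝓕 f v := by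
    intro v
    rw [SchwartzMap.fourier_coe, flip_innerₗ]
    rfl
  simp only [h1, h2, smul_eq_mul] at h
  rw [h]
  refine integral_congr_ae (Filter.Eventually.of_forall fun v => ?_)
  simp only [Circle.smul_def, smul_eq_mul, mul_assoc]

variable {m : R3 → ℝ} {c : ℝ} {hm : AEStronglyMeasurable m volume} {hc : ∀ᵐ x : R3, |m x| ≤ c}

theorem fourierMul_schwartz_ae (φ : 𝓢(R3, ℂ)) (hφ : ∀ w, φ w = m w) (f : 𝓢(R3, ℂ)) :
    fourierMul m c hm hc (f.toLp 2)
      =ᵐ[volume] fun y => inner ℂ (conjTranslate (𝓕 φ) y) (f.toLp 2) := by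
  set g : 𝓢(R3, ℂ) := SchwartzMap.smulLeftCLM ℂ φ (𝓕 f) with hg
  have hgapp : ∀ w, g w = φ w * 𝓕 f w := fun w => by
    rw [hg, SchwartzMap.smulLeftCLM_apply_apply φ.hasTemperateGrowth, smul_eq_mul]
  have h1 : boundedMul m c hm hc (plancherel (f.toLp 2)) = g.toLp 2 := by
    have h2 : plancherel (f.toLp 2) = (𝓕 f).toLp 2 := SchwartzMap.toLp_fourier_eq f
    rw [h2]
    apply Lp.ext
    filter_upwards [boundedMul_ae (hm := hm) (hc := hc) ((𝓕 f).toLp 2),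
      (𝓕 f).coeFn_toLp 2 volume, g.coeFn_toLp 2 volume] with w h3 h4 h5
    rw [h3, h4, h5, hgapp, hφ]
  have h6 : fourierMul m c hm hc (f.toLp 2) = (𝓕⁻ g).toLp 2 := by
    rw [fourierMul_apply, h1]
    exact SchwartzMap.toLp_fourierInv_eq g
  rw [h6]
  filter_upwards [(𝓕⁻ g).coeFn_toLp 2 volume] with y hy
  rw [hy, inner_conjTranslate, SchwartzMap.fourierInv_coe, Real.fourierInv_eq]
  simp only [hgapp]
  rw [integral_fourier_mul_eq_translate]
  refine integral_congr_ae ?_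
  filter_upwards [f.coeFn_toLp 2 volume] with z hz
  rw [hz]

/-- A Fourier multiplier with Schwartz symbol is an integral operator. -/
theorem fourierMul_ae (φ : 𝓢(R3, ℂ)) (hφ : ∀ w, φ w = m w) (u : L2R3) :
    fourierMul m c hm hc u =ᵐ[volume] fun y => inner ℂ (conjTranslate (𝓕 φ) y) u := by
  have hdense : DenseRange (SchwartzMap.toLpCLM ℝ ℂ 2 (volume : Measure R3)) :=
    SchwartzMap.denseRange_toLpCLM ENNReal.ofNat_ne_top
  obtain ⟨s, hs, hsu⟩ := mem_closure_iff_seq_limit.1 (hdense u)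
  choose f hf using hs
  have hconv : Filter.Tendsto (fun n => fourierMul m c hm hc (s n)) Filter.atTop
      (nhds (fourierMul m c hm hc u)) :=
    ((fourierMul m c hm hc).continuous.tendsto u).comp hsu
  -- Schwartz approximations converge almost everywhere along a subsequence on the left, and for
  -- every y on the right, as the inner product with a fixed kernel is continuous.
  obtain ⟨ns, hns, hae⟩ := (tendstoInMeasure_of_tendsto_Lp hconv).exists_seq_tendsto_ae
  have hall : ∀ᵐ y : R3, ∀ n, fourierMul m c hm hc (s n) y
      = inner ℂ (conjTranslate (𝓕 φ) y) (s n) := by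
    rw [ae_all_iff]
    intro n
    rw [← hf n]
    exact fourierMul_schwartz_ae φ hφ (f n)
  filter_upwards [hae, hall] with y h1 h2
  simp only [h2] at h1
  refine tendsto_nhds_unique h1 ?_
  exact (tendsto_const_nhds.inner hsu).comp hns.tendsto_atTop

/-- Bessel's inequality in a weighted `L²` space. -/
theorem sum_norm_inner_conjTranslate_sq_le {j : R3 → ℝ} {d : ℝ} {hjm : AEStronglyMeasurable j volume}
    {hjc : ∀ᵐ x : R3, |j x| ≤ d} (hj0 : ∀ x, 0 < j x) (φ : 𝓢(R3, ℂ)) {ρ : R3 → ℝ} {y : R3}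
    (hρ : ∀ z, (j z ^ 2)⁻¹ ≤ ρ (z - y)) (hint : Integrable (fun z => ρ z * ‖φ z‖ ^ 2) volume)
    {k : ℕ} {u : Fin k → L2R3} (hu : Orthonormal ℂ fun i => boundedMul j d hjm hjc (u i)) :
    ∑ i, ‖inner ℂ (conjTranslate φ y) (u i)‖ ^ 2 ≤ ∫ z, ρ z * ‖φ z‖ ^ 2 := by
  have hmeas : AEStronglyMeasurable (fun z => ((j z)⁻¹ : ℂ) * conjTranslate φ y z) volume :=
    (Complex.continuous_ofReal.comp_aestronglyMeasurable hjm).inv₀.mul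
      (Lp.aestronglyMeasurable _)
  have hle : ∀ᵐ z, ‖((j z)⁻¹ : ℂ) * conjTranslate φ y z‖ ^ 2 ≤ ρ (z - y) * ‖φ (z - y)‖ ^ 2 := by
    filter_upwards [MemLp.coeFn_toLp (memLp_conj_translate φ y)] with z hz
    rw [conjTranslate, hz, norm_mul, mul_pow, RCLike.norm_conj, norm_inv, Complex.norm_real,
      Real.norm_eq_abs, inv_pow, sq_abs]
    gcongr
    exact hρ z
  have hint' : Integrable (fun z => ρ (z - y) * ‖φ (z - y)‖ ^ 2) volume :=
    hint.comp_sub_right y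
  have hsq : Integrable (fun z => ‖((j z)⁻¹ : ℂ) * conjTranslate φ y z‖ ^ 2) volume := by
    refine hint'.mono' (hmeas.norm.pow 2) ?_
    filter_upwards [hle] with z hz
    rwa [Real.norm_eq_abs, abs_of_nonneg (by positivity)]
  have hmem := (memLp_two_iff_integrable_sq_norm hmeas).2 hsq
  set K : L2R3 := hmem.toLp with hK
  -- The weight is shifted from one factor to the other, so that Bessel applies to the orthonormal
  -- functions j · u i.
  have hinner : ∀ i, inner ℂ (conjTranslate φ y) (u i) = inner ℂ K (boundedMul j d hjm hjc (u i)) := by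
    intro i
    rw [L2.inner_def, L2.inner_def]
    refine integral_congr_ae ?_
    filter_upwards [MemLp.coeFn_toLp hmem, boundedMul_ae (hm := hjm) (hc := hjc) (u i)]
      with z h1 h2
    have h3 : (j z : ℂ) ≠ 0 := by exact_mod_cast (hj0 z).ne'
    rw [hK, h1, h2, RCLike.inner_apply, RCLike.inner_apply, map_mul, map_inv₀, Complex.conj_ofReal]
    field_simp
  calc ∑ i, ‖inner ℂ (conjTranslate φ y) (u i)‖ ^ 2
      = ∑ i, ‖inner ℂ (boundedMul j d hjm hjc (u i)) K‖ ^ 2 := by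
        refine Finset.sum_congr rfl fun i _ => ?_
        rw [hinner, norm_inner_symm]
    _ ≤ ‖K‖ ^ 2 := hu.sum_inner_products_le (s := Finset.univ) K
    _ = ∫ z, ‖((j z)⁻¹ : ℂ) * conjTranslate φ y z‖ ^ 2 := by
        rw [norm_sq_eq_integral]
        refine integral_congr_ae ?_
        filter_upwards [MemLp.coeFn_toLp hmem] with z h1
        rw [hK, h1]
    _ ≤ ∫ z, ρ (z - y) * ‖φ (z - y)‖ ^ 2 := integral_mono_ae hsq hint' hle
    _ = ∫ z, ρ z * ‖φ z‖ ^ 2 := integral_sub_right_eq_self (fun z => ρ z * ‖φ z‖ ^ 2) y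

/-- Weighted Hilbert-Schmidt bound for a Fourier multiplier localized to `B`. -/
theorem sum_norm_localized_fourierMul_sq_le {j : R3 → ℝ} {d : ℝ}
    {hjm : AEStronglyMeasurable j volume}
    {hjc : ∀ᵐ x : R3, |j x| ≤ d} (hj0 : ∀ x, 0 < j x) (φ : 𝓢(R3, ℂ)) (hφ : ∀ w, φ w = m w)
    {B : Set R3} (hB : MeasurableSet B) (hBfin : volume B ≠ ⊤)
    {hBm : AEStronglyMeasurable (B.indicator fun _ => (1 : ℝ)) (volume : Measure R3)}
    {hBc : ∀ᵐ x : R3, |B.indicator (fun _ => (1 : ℝ)) x| ≤ 1} {ρ : R3 → ℝ}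
    (hρ : ∀ y ∈ B, ∀ z, (j z ^ 2)⁻¹ ≤ ρ (z - y))
    (hint : Integrable (fun z => ρ z * ‖𝓕 φ z‖ ^ 2) volume)
    {k : ℕ} {u : Fin k → L2R3} (hu : Orthonormal ℂ fun i => boundedMul j d hjm hjc (u i)) :
    ∑ i, ‖(boundedMul _ 1 hBm hBc ∘L fourierMul m c hm hc) (u i)‖ ^ 2
      ≤ volume.real B * ∫ z, ρ z * ‖𝓕 φ z‖ ^ 2 := by
  simp only [ContinuousLinearMap.comp_apply, norm_boundedMul_sq]
  rw [← integral_finsetSum _ fun i _ => integrable_boundedMul_sq hBm hBc _]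
  have hall : ∀ᵐ y : R3, ∀ i, fourierMul m c hm hc (u i) y
      = inner ℂ (conjTranslate (𝓕 φ) y) (u i) := by
    rw [ae_all_iff]
    exact fun i => fourierMul_ae φ hφ (u i)
  have hBint : Integrable (B.indicator fun _ => ∫ z, ρ z * ‖𝓕 φ z‖ ^ 2) (volume : Measure R3) :=
    (integrable_indicator_iff hB).2 (integrableOn_const hBfin)
  calc _ ≤ ∫ y, B.indicator (fun _ => ∫ z, ρ z * ‖𝓕 φ z‖ ^ 2) y := by
        refine integral_mono_ae
          (integrable_finsetSum _ fun i _ => integrable_boundedMul_sq hBm hBc _) hBint ?_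
        filter_upwards [hall] with y hy
        by_cases hyB : y ∈ B
        · simp only [hyB, Set.indicator_of_mem, one_pow, one_mul, hy]
          exact sum_norm_inner_conjTranslate_sq_le hj0 (𝓕 φ) (hρ y hyB) hint hu
        · simp [hyB]
    _ = _ := by
        rw [integral_indicator hB, setIntegral_const, smul_eq_mul]

/-! ### Lower bounds on the symbol of the pair operator -/

theorem sqrt_add_sqrt_ge (x y u v : ℝ) :
    √((x + u) ^ 2 + (y + v) ^ 2) ≤ √(x ^ 2 + y ^ 2) + √(u ^ 2 + v ^ 2) := by
  have h := norm_add_le (⟨x, y⟩ : ℂ) ⟨u, v⟩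
  simpa only [Complex.norm_eq_sqrt_sq_add_sq, Complex.add_re, Complex.add_im] using h

theorem continuous_kinetic (s t : ℝ) : Continuous (kinetic s t) := by
  unfold kinetic
  fun_prop

theorem continuous_pairSymbol (mPlus mMinus p : ℝ) : Continuous (pairSymbol mPlus mMinus p) := by
  unfold pairSymbol
  exact ((continuous_kinetic _ _).add (continuous_kinetic _ _)).sub continuous_const

theorem sqrt_le_kinetic (s t : ℝ) (ξ : R3) : √((ξ 0 - s) ^ 2 + t ^ 2) ≤ kinetic s t ξ :=
  Real.sqrt_le_sqrt (by nlinarith [sq_nonneg (ξ 1), sq_nonneg (ξ 2)])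

theorem abs_le_kinetic (s t : ℝ) (ξ : R3) : |ξ 0 - s| ≤ kinetic s t ξ :=
  Real.abs_le_sqrt (by nlinarith [sq_nonneg (ξ 1), sq_nonneg (ξ 2), sq_nonneg t])

/-- The transversal momentum raises the kinetic energy. -/
theorem transversal_le_mul_kinetic_sub {s t D : ℝ} {ξ : R3}
    (hD : √((ξ 0 - s) ^ 2 + t ^ 2) ≤ D) :
    ξ 1 ^ 2 + ξ 2 ^ 2
      ≤ (2 * D + √(ξ 1 ^ 2 + ξ 2 ^ 2)) * (kinetic s t ξ - √((ξ 0 - s) ^ 2 + t ^ 2)) := by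
  have hT0 : 0 ≤ kinetic s t ξ := Real.sqrt_nonneg _
  have hT2 : kinetic s t ξ ^ 2 = (ξ 0 - s) ^ 2 + (ξ 1 ^ 2 + ξ 2 ^ 2) + t ^ 2 :=
    Real.sq_sqrt (by positivity)
  have hTA := sqrt_le_kinetic s t ξ
  set A := √((ξ 0 - s) ^ 2 + t ^ 2) with hA
  have hA0 : 0 ≤ A := Real.sqrt_nonneg _
  have hA2 : A ^ 2 = (ξ 0 - s) ^ 2 + t ^ 2 := Real.sq_sqrt (by positivity)
  set r := √(ξ 1 ^ 2 + ξ 2 ^ 2) with hr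
  have hr0 : 0 ≤ r := Real.sqrt_nonneg _
  have hr2 : r ^ 2 = ξ 1 ^ 2 + ξ 2 ^ 2 := Real.sq_sqrt (by positivity)
  have hTr : kinetic s t ξ ≤ A + r := by
    refine abs_le_of_sq_le_sq' ?_ (by positivity) |>.2
    nlinarith [mul_nonneg hA0 hr0]
  -- The transversal part is a difference of squares; the sum factor is at most 2A + r ≤ 2D + r.
  calc ξ 1 ^ 2 + ξ 2 ^ 2 = (kinetic s t ξ + A) * (kinetic s t ξ - A) := by
        rw [← sq_sub_sq, hT2, hA2]; ring
    _ ≤ _ := mul_le_mul_of_nonneg_right (by linarith) (by linarith)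

section PairSymbol

variable {mPlus mMinus p : ℝ}

/-- The planar vectors (μ₊ - η, μ₊M/p) and (η + μ₋, μ₋M/p) add up to (1, M/p). By the triangle
inequality the subtracted constant is at most the sum of the two energies at ζ = 0, and the
transversal excess of the first particle survives. -/
theorem kinetic_sub_le_pairSymbol (hPlus : 0 < mPlus) (hMinus : 0 < mMinus) (ξ : R3) :
    kinetic (mPlus / (mPlus + mMinus)) (mPlus / (mPlus + mMinus) * (mPlus + mMinus) / p) ξ
      - √((ξ 0 - mPlus / (mPlus + mMinus)) ^ 2
          + (mPlus / (mPlus + mMinus) * (mPlus + mMinus) / p) ^ 2)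
      ≤ pairSymbol mPlus mMinus p ξ := by
  have hM : mPlus + mMinus ≠ 0 := by positivity
  have h1 := sqrt_le_kinetic (-(mMinus / (mPlus + mMinus)))
    (mMinus / (mPlus + mMinus) * (mPlus + mMinus) / p) ξ
  have h2 := sqrt_add_sqrt_ge (mPlus / (mPlus + mMinus) - ξ 0)
    (mPlus / (mPlus + mMinus) * (mPlus + mMinus) / p)
    (ξ 0 - -(mMinus / (mPlus + mMinus))) (mMinus / (mPlus + mMinus) * (mPlus + mMinus) / p)
  have h3 : mPlus / (mPlus + mMinus) - ξ 0 + (ξ 0 - -(mMinus / (mPlus + mMinus))) = 1 := by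
    field_simp
    ring
  have h4 : mPlus / (mPlus + mMinus) * (mPlus + mMinus) / p
      + mMinus / (mPlus + mMinus) * (mPlus + mMinus) / p = (mPlus + mMinus) / p := by
    rw [div_mul_cancel₀ _ hM, div_mul_cancel₀ _ hM, add_div]
  rw [h3, h4, one_pow, div_pow,
    show (mPlus / (mPlus + mMinus) - ξ 0) ^ 2 = (ξ 0 - mPlus / (mPlus + mMinus)) ^ 2 by ring] at h2
  simp only [pairSymbol]
  linarith

theorem pairSymbol_nonneg (hPlus : 0 < mPlus) (hMinus : 0 < mMinus) (ξ : R3) :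
    0 ≤ pairSymbol mPlus mMinus p ξ :=
  (sub_nonneg.2 (sqrt_le_kinetic _ _ ξ)).trans (kinetic_sub_le_pairSymbol hPlus hMinus ξ)

/-- The 3 collects μ₊ + μ₋ = 1 and the bound 2 on the subtracted root, valid for p ≥ M. -/
theorem two_mul_abs_sub_le_pairSymbol (hPlus : 0 < mPlus) (hMinus : 0 < mMinus)
    (hp : mPlus + mMinus ≤ p) (ξ : R3) : 2 * |ξ 0| - 3 ≤ pairSymbol mPlus mMinus p ξ := by
  have hM : 0 < mPlus + mMinus := by positivity
  have hp0 : 0 < p := hM.trans_le hp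
  have h1 := abs_le_kinetic (mPlus / (mPlus + mMinus))
    (mPlus / (mPlus + mMinus) * (mPlus + mMinus) / p) ξ
  have h2 := abs_le_kinetic (-(mMinus / (mPlus + mMinus)))
    (mMinus / (mPlus + mMinus) * (mPlus + mMinus) / p) ξ
  have h3 := abs_sub_abs_le_abs_sub (ξ 0) (mPlus / (mPlus + mMinus))
  have h4 := abs_sub_abs_le_abs_sub (ξ 0) (-(mMinus / (mPlus + mMinus)))
  rw [abs_of_pos (div_pos hPlus hM)] at h3
  rw [abs_neg, abs_of_pos (div_pos hMinus hM)] at h4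
  have h5 : mPlus / (mPlus + mMinus) + mMinus / (mPlus + mMinus) = 1 := by
    rw [← add_div, div_self hM.ne']
  have h6 : √(1 + (mPlus + mMinus) ^ 2 / p ^ 2) ≤ 2 := by
    rw [Real.sqrt_le_left (by norm_num), ← div_pow]
    have h7 : (mPlus + mMinus) / p ≤ 1 := (div_le_one hp0).2 hp
    have h8 : 0 ≤ (mPlus + mMinus) / p := by positivity
    nlinarith
  simp only [pairSymbol]
  linarith

/-- Outside an anisotropic ball, `p H_p` is bounded below uniformly in `p ≥ M`. -/
theorem exists_le_mul_pairSymbol (hPlus : 0 < mPlus) (hMinus : 0 < mMinus) {κ : ℝ} (hκ : 0 < κ) :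
    ∃ ρ : ℝ, 0 < ρ ∧ ∀ p : ℝ, mPlus + mMinus ≤ p → ∀ ξ : R3,
      ρ ≤ ξ 0 ^ 2 + p * (ξ 1 ^ 2 + ξ 2 ^ 2) → κ ≤ p * pairSymbol mPlus mMinus p ξ := by
  set M := mPlus + mMinus with hM_def
  have hM : 0 < M := by positivity
  -- Chosen so that 2r - 3 = κ/M, which settles the case |η| ≥ r since p ≥ M.
  set r := (κ / M + 3) / 2 with hr
  have hr0 : 0 < r := by positivity
  -- For |η| < r the goal reduces to κ(2(r + 2) + s) ≤ ps², with s = |ζ|. The first summand makes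
  -- half of ps² cover 2κ(r + 2); the second gives ps ≥ 2κ, so the other half covers κs.
  set D := 2 * κ * (2 * (r + 2)) + 4 * κ ^ 2 / M with hD
  refine ⟨r ^ 2 + D, by positivity, fun p hp ξ hξ => ?_⟩
  have hp0 : 0 < p := hM.trans_le hp
  by_cases hη : r ≤ |ξ 0|
  · have h1 := two_mul_abs_sub_le_pairSymbol hPlus hMinus hp ξ
    have h2 : κ / M ≤ pairSymbol mPlus mMinus p ξ := by linarith
    calc κ = M * (κ / M) := by field_simp
      _ ≤ _ := mul_le_mul hp h2 (by positivity) hp0.le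
  · push Not at hη
    have h1 := kinetic_sub_le_pairSymbol (p := p) hPlus hMinus ξ
    rw [← hM_def] at h1
    set α := mPlus / M with hα
    have hα0 : 0 < α := div_pos hPlus hM
    have hα1 : α ≤ 1 := (div_le_one hM).2 (by linarith)
    set t := α * M / p with ht
    have ht0 : 0 ≤ t := by positivity
    have ht1 : t ≤ 1 := by
      rw [ht, div_le_one hp0]
      nlinarith
    have hA : √((ξ 0 - α) ^ 2 + t ^ 2) ≤ r + 2 := by
      rw [Real.sqrt_le_left (by positivity)]
      have h2 : |ξ 0 - α| ≤ r + 1 := by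
        rw [abs_le]
        have := abs_lt.1 hη
        constructor <;> linarith
      have h3 : (ξ 0 - α) ^ 2 ≤ (r + 1) ^ 2 := sq_le_sq' (by linarith [(abs_le.1 h2).1])
        (abs_le.1 h2).2
      nlinarith
    have h2 := transversal_le_mul_kinetic_sub hA
    set s := √(ξ 1 ^ 2 + ξ 2 ^ 2) with hs
    have hs0 : 0 ≤ s := Real.sqrt_nonneg _
    have hs2 : s ^ 2 = ξ 1 ^ 2 + ξ 2 ^ 2 := Real.sq_sqrt (by positivity)
    have h3 : ξ 0 ^ 2 < r ^ 2 := by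
      rw [← sq_abs]
      exact pow_lt_pow_left₀ hη (abs_nonneg _) two_ne_zero
    rw [← hs2] at h2 hξ
    have h4 : D ≤ p * s ^ 2 := by linarith
    have h5 : 2 * κ ≤ p * s := by
      refine abs_le_of_sq_le_sq' ?_ (by positivity) |>.2
      have h6 : 4 * κ ^ 2 / M ≤ p * s ^ 2 := by
        have : 0 ≤ 2 * κ * (2 * (r + 2)) := by positivity
        linarith
      calc (2 * κ) ^ 2 = M * (4 * κ ^ 2 / M) := by field_simp; ring
        _ ≤ p * (p * s ^ 2) := mul_le_mul hp h6 (by positivity) hp0.le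
        _ = _ := by ring
    have h7 : κ * (2 * (r + 2) + s) ≤ p * s ^ 2 := by
      have h8 : 2 * κ * (2 * (r + 2)) ≤ p * s ^ 2 := by
        have : 0 ≤ 4 * κ ^ 2 / M := by positivity
        linarith
      have h9 : 2 * κ * s ≤ p * s ^ 2 := by
        have := mul_le_mul_of_nonneg_right h5 hs0
        nlinarith
      linarith
    have h10 : 0 < 2 * (r + 2) + s := by positivity
    have h11 : p * s ^ 2 ≤ (2 * (r + 2) + s) * (p * pairSymbol mPlus mMinus p ξ) := by
      calc p * s ^ 2 ≤ p * ((2 * (r + 2) + s) * (kinetic α t ξ - √((ξ 0 - α) ^ 2 + t ^ 2))) := by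
            gcongr
        _ ≤ p * ((2 * (r + 2) + s) * pairSymbol mPlus mMinus p ξ) := by gcongr
        _ = _ := by ring
    nlinarith

end PairSymbol

/-! ### Anisotropic scaling -/

/-- The scaling `(η, ζ) ↦ (η, s ζ)` of `ℝ × ℝ²`. -/
def anisoScale (s : ℝ) : R3 →ₗ[ℝ] R3 :=
  Matrix.toLin (PiLp.basisFun 2 ℝ (Fin 3)) (PiLp.basisFun 2 ℝ (Fin 3))
    (Matrix.diagonal ![1, s, s])

theorem anisoScale_apply (s : ℝ) (w : R3) (i : Fin 3) :
    anisoScale s w i = (![1, s, s] : Fin 3 → ℝ) i * w i := by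
  rw [anisoScale, ← Matrix.toLpLin_eq_toLin, Matrix.toLpLin_apply]
  simp [Matrix.mulVec_diagonal]

theorem det_anisoScale (s : ℝ) : LinearMap.det (anisoScale s) = s ^ 2 := by
  rw [anisoScale, LinearMap.det_toLin, Matrix.det_diagonal, Fin.prod_univ_three]
  simp [sq]

theorem continuous_anisoScale (s : ℝ) : Continuous (anisoScale s) :=
  LinearMap.continuous_of_finiteDimensional _

/-- The scaling `(η, ζ) ↦ (η, s ζ)` as a linear equivalence. -/
def anisoScaleEquiv (s : ℝ) (hs : 0 < s) : R3 ≃L[ℝ] R3 :=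
  (LinearMap.equivOfDetNeZero (anisoScale s)
    (by rw [det_anisoScale]; positivity)).toContinuousLinearEquiv

theorem norm_sq_R3 (w : R3) : ‖w‖ ^ 2 = w 0 ^ 2 + w 1 ^ 2 + w 2 ^ 2 := by
  rw [EuclideanSpace.norm_sq_eq, Fin.sum_univ_three]
  simp only [Real.norm_eq_abs, sq_abs]

theorem norm_anisoScale_sq (s : ℝ) (w : R3) :
    ‖anisoScale s w‖ ^ 2 = w 0 ^ 2 + s ^ 2 * (w 1 ^ 2 + w 2 ^ 2) := by
  rw [norm_sq_R3, anisoScale_apply, anisoScale_apply, anisoScale_apply]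
  simp
  ring

theorem norm_anisoScale_le {s : ℝ} (hs : 0 ≤ s) (w : R3) :
    ‖anisoScale s w‖ ≤ (1 + s) * ‖w‖ := by
  refine abs_le_of_sq_le_sq' ?_ (by positivity) |>.2
  rw [mul_pow, norm_anisoScale_sq, norm_sq_R3]
  nlinarith [sq_nonneg (w 0), sq_nonneg (w 1), sq_nonneg (w 2),
    mul_nonneg hs (sq_nonneg (w 0)), mul_nonneg hs (sq_nonneg (w 1)),
    mul_nonneg hs (sq_nonneg (w 2)), mul_nonneg (sq_nonneg s) (sq_nonneg (w 0))]

theorem inner_anisoScale_comm (s : ℝ) (v w : R3) :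
    inner ℝ v (anisoScale s w) = inner ℝ (anisoScale s v) w := by
  simp only [PiLp.inner_apply, anisoScale_apply, RCLike.inner_apply, conj_trivial]
  refine Finset.sum_congr rfl fun i _ => ?_
  ring

theorem map_anisoScale {s : ℝ} (hs : 0 < s) :
    Measure.map (anisoScale s) (volume : Measure R3)
      = ENNReal.ofReal ((s ^ 2)⁻¹) • (volume : Measure R3) := by
  rw [Measure.map_linearMap_addHaar_eq_smul_addHaar volume
    (by rw [det_anisoScale]; positivity), det_anisoScale, abs_of_pos (by positivity)]

theorem integral_comp_anisoScale {F : Type*} [NormedAddCommGroup F] [NormedSpace ℝ F]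
    {s : ℝ} (hs : 0 < s) {f : R3 → F} (hf : Continuous f) :
    ∫ w, f (anisoScale s w) = (s ^ 2)⁻¹ • ∫ w, f w := by
  rw [← integral_map (continuous_anisoScale s).aemeasurable hf.aestronglyMeasurable,
    map_anisoScale hs, integral_smul_measure, ENNReal.toReal_ofReal (by positivity)]

theorem integrable_of_comp_anisoScale {F : Type*} [NormedAddCommGroup F]
    {s : ℝ} (hs : 0 < s) {f : R3 → F} (hf : Continuous f)
    (h : Integrable (fun w => f (anisoScale s w)) (volume : Measure R3)) :
    Integrable f (volume : Measure R3) := by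
  have h1 : Integrable f (Measure.map (anisoScale s) (volume : Measure R3)) :=
    (integrable_map_measure hf.aestronglyMeasurable
      (continuous_anisoScale s).aemeasurable).2 h
  rw [map_anisoScale hs] at h1
  exact (integrable_smul_measure (by simpa using hs.ne') ENNReal.ofReal_ne_top).1 h1

/-- Composition of a Schwartz function with the anisotropic scaling. -/
def scaledSchwartz (s : ℝ) (hs : 0 < s) (φ : 𝓢(R3, ℂ)) : 𝓢(R3, ℂ) :=
  SchwartzMap.compCLMOfContinuousLinearEquiv ℂ (anisoScaleEquiv s hs) φ

theorem scaledSchwartz_apply (s : ℝ) (hs : 0 < s) (φ : 𝓢(R3, ℂ)) (w : R3) :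
    scaledSchwartz s hs φ w = φ (anisoScale s w) := rfl

/-- The scaling is symmetric with determinant s², so this is a change of variables. Evaluating at
the scaled point avoids the inverse scaling. -/
theorem fourier_scaledSchwartz (s : ℝ) (hs : 0 < s) (φ : 𝓢(R3, ℂ)) (z : R3) :
    𝓕 (scaledSchwartz s hs φ) (anisoScale s z) = ((s ^ 2)⁻¹ : ℝ) • 𝓕 φ z := by
  rw [SchwartzMap.fourier_coe, SchwartzMap.fourier_coe, Real.fourier_eq, Real.fourier_eq]
  simp only [inner_anisoScale_comm, scaledSchwartz_apply]
  refine integral_comp_anisoScale hs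
    (f := fun v => Real.fourierChar (-(inner ℝ v z)) • φ v) ?_
  exact (Real.continuous_fourierChar.comp (continuous_id.inner continuous_const).neg).smul
    φ.continuous

/-! ### Polynomially weighted integrals of Schwartz functions -/

/-- One factor ‖ψ‖ is bounded by its supremum; the other absorbs a polynomial whose degree is γ
rounded up. -/
theorem integrable_rpow_mul_norm_sq (ψ : 𝓢(R3, ℂ)) {κ γ : ℝ} (hκ : 0 ≤ κ) (hγ : 0 ≤ γ) :
    Integrable (fun z => (1 + κ * ‖z‖) ^ γ * ‖ψ z‖ ^ 2) (volume : Measure R3) := by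
  set N := ⌈γ⌉₊ with hN
  set b := SchwartzMap.seminorm ℝ 0 0 ψ with hb
  have h1 : Integrable (fun z => 2 ^ (N - 1) * b * (‖z‖ ^ 0 * ‖ψ z‖ + κ ^ N * (‖z‖ ^ N * ‖ψ z‖)))
      (volume : Measure R3) :=
    ((ψ.integrable_pow_mul volume 0).add
      ((ψ.integrable_pow_mul volume N).const_mul _)).const_mul _
  have hcont : Continuous fun z : R3 => (1 + κ * ‖z‖) ^ γ * ‖ψ z‖ ^ 2 := by
    refine ((continuous_const.add (continuous_const.mul continuous_norm)).rpow_const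
      fun z => Or.inr hγ).mul (ψ.continuous.norm.pow 2)
  refine h1.mono' hcont.aestronglyMeasurable (Filter.Eventually.of_forall fun z => ?_)
  have hz : 0 ≤ κ * ‖z‖ := by positivity
  have h2 : (1 + κ * ‖z‖) ^ γ ≤ 2 ^ (N - 1) * (1 + κ ^ N * ‖z‖ ^ N) := by
    calc (1 + κ * ‖z‖) ^ γ ≤ (1 + κ * ‖z‖) ^ (N : ℝ) :=
          Real.rpow_le_rpow_of_exponent_le (by linarith) (Nat.le_ceil γ)
      _ = (1 + κ * ‖z‖) ^ N := Real.rpow_natCast _ _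
      _ ≤ 2 ^ (N - 1) * (1 ^ N + (κ * ‖z‖) ^ N) := add_pow_le zero_le_one hz N
      _ = _ := by rw [one_pow, mul_pow]
  have h3 : ‖ψ z‖ ≤ b := SchwartzMap.norm_le_seminorm ℝ ψ z
  have h4 : 0 ≤ ‖ψ z‖ := norm_nonneg _
  have h5 : ‖ψ z‖ ^ 2 ≤ b * ‖ψ z‖ := by nlinarith
  rw [Real.norm_eq_abs, abs_of_nonneg (by positivity)]
  calc (1 + κ * ‖z‖) ^ γ * ‖ψ z‖ ^ 2
      ≤ (2 ^ (N - 1) * (1 + κ ^ N * ‖z‖ ^ N)) * (b * ‖ψ z‖) := by gcongr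
    _ = _ := by ring

/-- The weighted square integral of the transform of a scaled symbol. -/
theorem weighted_integral_fourier_scaled (φ : 𝓢(R3, ℂ)) {M p γ : ℝ} (hM : 0 < M) (hp : M ≤ p)
    (hγ : 0 ≤ γ) (hs : 0 < √p) :
    Integrable (fun z => (1 + ‖z‖ / p) ^ γ * ‖𝓕 (scaledSchwartz (√p) hs φ) z‖ ^ 2)
        (volume : Measure R3) ∧
      ∫ z, (1 + ‖z‖ / p) ^ γ * ‖𝓕 (scaledSchwartz (√p) hs φ) z‖ ^ 2
        ≤ p⁻¹ * ∫ z, (1 + (1 / M + 1 / √M) * ‖z‖) ^ γ * ‖𝓕 φ z‖ ^ 2 := by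
  have hp0 : 0 < p := hM.trans_le hp
  set g : R3 → ℝ := fun z => (1 + ‖z‖ / p) ^ γ * ‖𝓕 (scaledSchwartz (√p) hs φ) z‖ ^ 2 with hg
  have hgc : Continuous g :=
    ((continuous_const.add (continuous_norm.div_const p)).rpow_const
      fun z => Or.inr hγ).mul ((𝓕 (scaledSchwartz (√p) hs φ)).continuous.norm.pow 2)
  have hint := (integrable_rpow_mul_norm_sq (𝓕 φ) (κ := 1 / M + 1 / √M) (by positivity) hγ).const_mul
    ((p ^ 2)⁻¹)
  have hnorm : ∀ z : R3, ‖anisoScale (√p) z‖ / p ≤ (1 / M + 1 / √M) * ‖z‖ := by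
    intro z
    -- Here p ≥ M makes the rescaled weight uniform in p.
    have h1 : (1 + √p) / p ≤ 1 / M + 1 / √M := by
      rw [add_div, Real.sqrt_div_self']
      gcongr
    calc ‖anisoScale (√p) z‖ / p ≤ (1 + √p) * ‖z‖ / p := by
          gcongr
          exact norm_anisoScale_le (Real.sqrt_nonneg p) z
      _ = (1 + √p) / p * ‖z‖ := by ring
      _ ≤ _ := by gcongr
  have hle : ∀ z, g (anisoScale (√p) z)
      ≤ (p ^ 2)⁻¹ * ((1 + (1 / M + 1 / √M) * ‖z‖) ^ γ * ‖𝓕 φ z‖ ^ 2) := by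
    intro z
    simp only [hg]
    rw [fourier_scaledSchwartz, norm_smul, mul_pow, Real.sq_sqrt hp0.le, Real.norm_eq_abs, sq_abs,
      inv_pow, mul_left_comm]
    gcongr
    exact hnorm z
  have hgint : Integrable (fun z => g (anisoScale (√p) z)) (volume : Measure R3) := by
    refine hint.mono' (hgc.comp (continuous_anisoScale _)).aestronglyMeasurable
      (Filter.Eventually.of_forall fun z => ?_)
    rw [Real.norm_eq_abs, abs_of_nonneg (by simp only [hg]; positivity)]
    exact hle z
  refine ⟨integrable_of_comp_anisoScale hs hgc hgint, ?_⟩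
  have h1 := integral_comp_anisoScale hs hgc
  rw [Real.sq_sqrt hp0.le, smul_eq_mul] at h1
  have h2 : ∫ z, g (anisoScale (√p) z)
      ≤ (p ^ 2)⁻¹ * ∫ z, (1 + (1 / M + 1 / √M) * ‖z‖) ^ γ * ‖𝓕 φ z‖ ^ 2 := by
    rw [← integral_const_mul]
    exact integral_mono hgint hint hle
  -- The Jacobian contributes p and the squared amplitude p⁻²: the net p⁻¹ is the momentum volume of
  -- the cutoff.
  calc ∫ z, g z = p * ∫ z, g (anisoScale (√p) z) := by rw [h1]; field_simp
    _ ≤ p * ((p ^ 2)⁻¹ * ∫ z, (1 + (1 / M + 1 / √M) * ‖z‖) ^ γ * ‖𝓕 φ z‖ ^ 2) := by gcongr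
    _ = _ := by field_simp

/-! ### The weight -/

/-- The square root of the scaled lower bound `(1 + (|x| - b)₊)^{-γ}`, at `x = y / p`. -/
def sqrtWeight (b γ p : ℝ) (y : R3) : ℝ := (1 + max (‖y‖ / p - b) 0) ^ (-γ / 2)

theorem one_le_weight_base (b p : ℝ) (y : R3) : 1 ≤ 1 + max (‖y‖ / p - b) 0 := by
  linarith [le_max_right (‖y‖ / p - b) 0]

theorem sqrtWeight_pos (b γ p : ℝ) (y : R3) : 0 < sqrtWeight b γ p y :=
  Real.rpow_pos_of_pos (zero_lt_one.trans_le (one_le_weight_base b p y)) _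

theorem sqrtWeight_le_one {γ : ℝ} (hγ : 0 ≤ γ) (b p : ℝ) (y : R3) : |sqrtWeight b γ p y| ≤ 1 := by
  rw [abs_of_pos (sqrtWeight_pos b γ p y)]
  exact Real.rpow_le_one_of_one_le_of_nonpos (one_le_weight_base b p y) (by linarith)

theorem continuous_sqrtWeight (b γ p : ℝ) : Continuous (sqrtWeight b γ p) := by
  refine Continuous.rpow_const ?_ fun y =>
    Or.inl (zero_lt_one.trans_le (one_le_weight_base b p y)).ne'
  fun_prop

theorem sqrtWeight_sq (b γ p : ℝ) (y : R3) :
    sqrtWeight b γ p y ^ 2 = (1 + max (‖y‖ / p - b) 0) ^ (-γ) := by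
  rw [sqrtWeight, ← Real.rpow_natCast, ← Real.rpow_mul
    (zero_le_one.trans (one_le_weight_base b p y))]
  congr 1
  push_cast
  ring

/-- For y in the ball, ‖z‖/p - b ≤ ‖z - y‖/p. The bound depends only on z - y and no longer on b,
which makes the final constant uniform in b. -/
theorem inv_sqrtWeight_sq_le {b γ p : ℝ} (hγ : 0 ≤ γ) (hp : 0 < p) {y : R3} (hy : ‖y‖ / p < b)
    (z : R3) : (sqrtWeight b γ p z ^ 2)⁻¹ ≤ (1 + ‖z - y‖ / p) ^ γ := by
  have h0 := one_le_weight_base b p z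
  rw [sqrtWeight_sq, Real.rpow_neg (zero_le_one.trans h0), inv_inv]
  refine Real.rpow_le_rpow (by linarith) ?_ hγ
  have h1 : ‖z‖ / p ≤ ‖z - y‖ / p + ‖y‖ / p := by
    rw [← add_div]
    gcongr
    simpa using norm_add_le (z - y) y
  gcongr
  exact max_le (by linarith) (by positivity)

/-- The scaled potential is repulsive away from the ball of radius `b p`. -/
theorem neg_scaledPotential_ge {V : R3 → ℝ} {a γ K b p : ℝ} (hp : 0 < p)
    (hK : ∀ᵐ x : R3, |V x| ≤ K)
    (hV : ∀ᵐ x : R3, b ≤ ‖x‖ → V x ≤ -a * (1 + ‖x‖ - b) ^ (-γ)) :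
    ∀ᵐ y : R3, a / p * sqrtWeight b γ p y ^ 2
      - (K + a) / p * (Metric.ball (0 : R3) (b * p)).indicator (fun _ => (1 : ℝ)) y
      ≤ -scaledPotential V p y := by
  have hq : Measure.QuasiMeasurePreserving (fun y : R3 => p⁻¹ • y) volume volume := by
    refine ⟨measurable_const_smul _, ?_⟩
    rw [Measure.map_addHaar_smul volume (inv_ne_zero hp.ne')]
    exact Measure.smul_absolutelyContinuous
  filter_upwards [hq.ae hK, hq.ae hV] with y h1 h2
  have hn : ‖p⁻¹ • y‖ = ‖y‖ / p := by
    rw [norm_smul, Real.norm_eq_abs, abs_of_pos (inv_pos.2 hp), div_eq_inv_mul]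
  rw [hn] at h2
  have hmain : a * sqrtWeight b γ p y ^ 2
      - (K + a) * (Metric.ball (0 : R3) (b * p)).indicator (fun _ => (1 : ℝ)) y
      ≤ -V (p⁻¹ • y) := by
    rw [sqrtWeight_sq]
    by_cases hy : ‖y‖ / p < b
    · have hmem : y ∈ Metric.ball (0 : R3) (b * p) := by
        rw [mem_ball_zero_iff]
        exact (div_lt_iff₀ hp).1 hy
      -- Inside the ball the weight is 1, and the claim is -K = a - (K + a) ≤ -V.
      rw [Set.indicator_of_mem hmem, max_eq_right (by linarith), add_zero, Real.one_rpow]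
      linarith [(abs_le.1 h1).2]
    · push Not at hy
      have hmem : y ∉ Metric.ball (0 : R3) (b * p) := by
        rw [mem_ball_zero_iff, not_lt]
        exact (le_div_iff₀ hp).1 hy
      rw [Set.indicator_of_notMem hmem, max_eq_left (by linarith), ← add_sub_assoc]
      linarith [h2 hy]
  calc _ = p⁻¹ * (a * sqrtWeight b γ p y ^ 2
      - (K + a) * (Metric.ball (0 : R3) (b * p)).indicator (fun _ => (1 : ℝ)) y) := by ring
    _ ≤ p⁻¹ * -V (p⁻¹ • y) := by gcongr
    _ = _ := by rw [scaledPotential]; ring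

/-- A smooth cutoff, equal to one where `p H_p` is small, that is adapted to all `p ≥ M` by
anisotropic scaling. -/
theorem exists_cutoff {mPlus mMinus : ℝ} (hPlus : 0 < mPlus) (hMinus : 0 < mMinus) {κ : ℝ}
    (hκ : 0 < κ) :
    ∃ (χ : R3 → ℝ) (φ : 𝓢(R3, ℂ)), Continuous χ ∧ (∀ w, |χ w| ≤ 1) ∧ (∀ w, φ w = χ w) ∧
      ∀ p : ℝ, mPlus + mMinus ≤ p → ∀ w,
        κ / p * (1 - χ (anisoScale (√p) w)) ^ 2 ≤ freqSymbol (pairSymbol mPlus mMinus p) w := by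
  obtain ⟨ρ, hρ, hlow⟩ := exists_le_mul_pairSymbol hPlus hMinus hκ
  set χ : ContDiffBump (0 : R3) := ⟨√ρ, √ρ + 1, by positivity, by linarith⟩ with hχ
  have hsupp : HasCompactSupport fun x => ((χ x : ℝ) : ℂ) :=
    χ.hasCompactSupport.comp_left Complex.ofReal_zero
  have hsmooth : ContDiff ℝ ((⊤ : ℕ∞) : WithTop ℕ∞) fun x => ((χ x : ℝ) : ℂ) :=
    Complex.ofRealCLM.contDiff.comp χ.contDiff
  refine ⟨χ, hsupp.toSchwartzMap hsmooth, χ.continuous, fun w => ?_, fun w => rfl,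
    fun p hp w => ?_⟩
  · rw [abs_of_nonneg χ.nonneg]
    exact χ.le_one
  · have hp0 : 0 < p := (add_pos hPlus hMinus).trans_le hp
    by_cases hw : ‖anisoScale (√p) w‖ ≤ √ρ
    · have h1 : χ (anisoScale (√p) w) = 1 :=
        χ.one_of_mem_closedBall (by rwa [mem_closedBall_zero_iff])
      rw [h1]
      simpa using pairSymbol_nonneg hPlus hMinus _
    · push Not at hw
      have h1 : ρ ≤ ‖anisoScale (√p) w‖ ^ 2 := by
        rw [← Real.sq_sqrt hρ.le]
        exact pow_le_pow_left₀ (Real.sqrt_nonneg _) hw.le 2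
      rw [norm_anisoScale_sq, Real.sq_sqrt hp0.le] at h1
      -- The symbol is evaluated at -2πw, whose anisotropic norm is larger than that of w, so the
      -- same threshold ρ works.
      have hpi : 1 ≤ (2 * Real.pi) ^ 2 := by nlinarith [Real.pi_gt_three]
      have h2 : ρ ≤ (-(2 * Real.pi) • w : R3) 0 ^ 2
          + p * ((-(2 * Real.pi) • w : R3) 1 ^ 2 + (-(2 * Real.pi) • w : R3) 2 ^ 2) := by
        simp only [PiLp.smul_apply, smul_eq_mul]
        have h3 : 0 ≤ w 0 ^ 2 + p * (w 1 ^ 2 + w 2 ^ 2) := by positivity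
        nlinarith [mul_le_mul_of_nonneg_right hpi h3]
      have h4 := hlow p hp _ h2
      have h5 : (1 - χ (anisoScale (√p) w)) ^ 2 ≤ 1 := by
        have h6 := χ.nonneg (x := anisoScale (√p) w)
        have h7 := χ.le_one (x := anisoScale (√p) w)
        nlinarith
      calc κ / p * (1 - χ (anisoScale (√p) w)) ^ 2 ≤ κ / p * 1 := by gcongr
        _ ≤ _ := by
          rw [mul_one, div_le_iff₀ hp0, mul_comm]
          exact h4

end PairOperator

end

/-! ### The bound on the number of negative eigenvalues -/

theorem theoremA1 (mPlus mMinus : ℝ) (hPlus : 0 < mPlus) (hMinus : 0 < mMinus)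
    (a γ K : ℝ) (ha : 0 < a) (hγ : 0 < γ) (hK : 0 ≤ K) :
    ∃ C : ℝ, ∀ (b : ℝ) (V : PairOperator.R3 → ℝ), 0 < b →
      AEStronglyMeasurable V volume →
      eLpNorm V ∞ volume ≤ ENNReal.ofReal K →
      (∀ᵐ x : PairOperator.R3, b ≤ ‖x‖ → V x ≤ -a * (1 + ‖x‖ - b) ^ (-γ)) →
      ∀ p : ℝ, mPlus + mMinus ≤ p →
        (PairOperator.countN mPlus mMinus V p : ℝ≥0∞) ≤
          ENNReal.ofReal (C * (b + 1) ^ 3 * p ^ 2) := by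
  open PairOperator in
  set M := mPlus + mMinus with hM_def
  have hM : 0 < M := add_pos hPlus hMinus
  obtain ⟨χ, φ, hχc, hχ1, hφ, hlow⟩ :=
    -- With α = (K + a)/p this κ gives κ/p = 2α, as `form_lower_bound` requires. The cutoff is fixed
    -- before b, V and p.
    exists_cutoff hPlus hMinus (κ := 2 * (K + a)) (by positivity)
  set I : ℝ := ∫ z, (1 + (1 / M + 1 / √M) * ‖z‖) ^ γ * ‖𝓕 φ z‖ ^ 2 with hI
  have hI0 : 0 ≤ I := integral_nonneg fun z => by positivity
  set v₁ : ℝ := volume.real (Metric.ball (0 : R3) 1) with hv₁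
  have hv₁0 : 0 ≤ v₁ := measureReal_nonneg
  refine ⟨2 * (K + a) * v₁ * I / a, fun b V hb hVm hVK hV p hp => ?_⟩
  have hp0 : 0 < p := hM.trans_le hp
  have hs : 0 < √p := Real.sqrt_pos.2 hp0
  have hVae : ∀ᵐ x : R3, |V x| ≤ K := by
    rw [eLpNorm_exponent_top] at hVK
    filter_upwards [ae_le_eLpNormEssSup (f := V) (μ := (volume : Measure R3))] with x hx
    have h1 := hx.trans hVK
    rwa [← ofReal_norm, ENNReal.ofReal_le_ofReal_iff hK, Real.norm_eq_abs] at h1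
  have hq : Measure.QuasiMeasurePreserving (fun y : R3 => p⁻¹ • y) volume volume := by
    refine ⟨measurable_const_smul _, ?_⟩
    rw [Measure.map_addHaar_smul volume (inv_ne_zero hp0.ne')]
    exact Measure.smul_absolutelyContinuous
  have hvm : AEStronglyMeasurable (scaledPotential V p) volume :=
    (hVm.comp_quasiMeasurePreserving hq).const_mul p⁻¹
  have hvc : ∀ᵐ y : R3, |scaledPotential V p y| ≤ p⁻¹ * K := by
    filter_upwards [hq.ae hVae] with y hy
    rw [scaledPotential, abs_mul, abs_of_pos (inv_pos.2 hp0)]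
    gcongr
  set B : Set R3 := Metric.ball 0 (b * p) with hB
  have hBmeas : MeasurableSet B := Metric.isOpen_ball.measurableSet
  have hBm : AEStronglyMeasurable (B.indicator fun _ => (1 : ℝ)) (volume : Measure R3) :=
    (measurable_const.indicator hBmeas).aestronglyMeasurable
  have hBc : ∀ᵐ x : R3, |B.indicator (fun _ => (1 : ℝ)) x| ≤ 1 :=
    Filter.Eventually.of_forall fun x => by by_cases hx : x ∈ B <;> simp [hx]
  have hmm : AEStronglyMeasurable (fun w => χ (anisoScale (√p) w)) (volume : Measure R3) :=
    (hχc.comp (continuous_anisoScale _)).aestronglyMeasurable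
  have hmc : ∀ᵐ w : R3, |χ (anisoScale (√p) w)| ≤ 1 :=
    Filter.Eventually.of_forall fun w => hχ1 _
  have hjm : AEStronglyMeasurable (sqrtWeight b γ p) (volume : Measure R3) :=
    (continuous_sqrtWeight b γ p).aestronglyMeasurable
  have hjc : ∀ᵐ y : R3, |sqrtWeight b γ p y| ≤ 1 :=
    Filter.Eventually.of_forall (sqrtWeight_le_one hγ.le b p)
  have hform := form_lower_bound (h := pairSymbol mPlus mMinus p) (v := scaledPotential V p)
    (α := (K + a) / p) (β := a / p) (B := B) (by positivity) hmm hmc hjm hjc hBm hBc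
    (fun w => by
      have := hlow p hp w
      rwa [mul_div_assoc] at this)
    (neg_scaledPotential_ge hp0 hVae hV)
  obtain ⟨hint, hle⟩ := weighted_integral_fourier_scaled φ hM hp hγ.le hs
  have hvolB : volume.real B = (b * p) ^ 3 * v₁ := by
    rw [hB, measureReal_def, Measure.addHaar_ball _ _ (by positivity), ENNReal.toReal_mul,
      ENNReal.toReal_ofReal (by positivity)]
    simp [hv₁, measureReal_def]
  have hbound : ∀ (k : ℕ) (v : Fin k → (pairOperator mPlus mMinus V p).domain),
      IsNegFamily (pairOperator mPlus mMinus V p) v →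
        (k : ℝ) ≤ 2 * (K + a) * v₁ * I / a * b ^ 3 * p ^ 2 := by
    intro k v hv
    have h1 := IsNegFamily.mul_card_le (S := (b * p) ^ 3 * v₁ * (p⁻¹ * I))
      (boundedMul_injective (Filter.Eventually.of_forall fun y => (sqrtWeight_pos b γ p y).ne'))
      (by positivity) hform (fun n u hu => by
        refine (sum_norm_localized_fourierMul_sq_le (sqrtWeight_pos b γ p)
          (scaledSchwartz (√p) hs φ) (fun w => by rw [scaledSchwartz_apply, hφ]) hBmeas
          measure_ball_lt_top.ne (fun y hy z => inv_sqrtWeight_sq_le hγ.le hp0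
            ((div_lt_iff₀ hp0).2 (mem_ball_zero_iff.1 hy)) z) hint hu).trans ?_
        rw [hvolB]
        gcongr) hv
    have h2 : (k : ℝ) = p / a * (a / p * k) := by field_simp
    rw [h2]
    -- The factors 1/p in α and β cancel, leaving (bp)³ · p⁻¹ = b³p².
    calc p / a * (a / p * k)
        ≤ p / a * (2 * ((K + a) / p) * ((b * p) ^ 3 * v₁ * (p⁻¹ * I))) := by gcongr
      _ = _ := by field_simp
  have hcount : countN mPlus mMinus V p
      ≤ (⌊2 * (K + a) * v₁ * I / a * b ^ 3 * p ^ 2⌋₊ : ℕ) :=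
    negEigenvalueCount_le (inner_sub_comm _ _)
      (inResolventSet_sub (continuous_pairSymbol mPlus mMinus p).measurable
        (pairSymbol_nonneg hPlus hMinus) (by positivity) hvm hvc)
      fun k v hv => Nat.le_floor (hbound k v hv)
  have hcast := ENat.toENNReal_le.2 hcount
  refine hcast.trans ?_
  rw [ENat.toENNReal_coe, ← ENNReal.ofReal_natCast]
  refine ENNReal.ofReal_le_ofReal ((Nat.floor_le (by positivity)).trans ?_)
  gcongr
  linarith
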